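/- Let $p,q$ be nonnegative integers, $A_1,\dots,A_p>0$, $B_1,\dots,B_q>0$, $a_1,\dots,a_p,b_1,\dots,b_q\in\mathbb{R}$ with $\sum_{j}B_j=\sum_{k}A_k$, and put $$W(x)=\frac{\prod_{k=1}^p\Gamma(A_kx+a_k)}{\prod_{j=1}^q\Gamma(B_jx+b_j)},\qquad \rho=\prod_{k=1}^pA_k^{A_k}\prod_{j=1}^qB_j^{-B_j},\qquad \mu=\sum_{j=1}^qb_j-\sum_{k=1}^pa_k+\frac{p-q}{2},$$ $$\nu=(2\pi)^{(p-q)/2}\prod_{k=1}^pA_k^{a_k-1/2}\prod_{j=1}^qB_j^{1/2-b_j}.$$ For $0<x<\rho$ let $$H(x)=\frac{1}{2\pi i}\int_{\mathcal L}\frac{\prod_{k=1}^p\Gamma(A_ks+a_k)}{\prod_{j=1}^q\Gamma(B_js+b_j)}\,x^{-s}\,ds$$ be the delta neutral Fox function $H^{p,0}_{q,p}$, where $\mathcal L$ is a left loop: for some reals $\varphi_1<0<\varphi_2$ and $c$ with $c>-a_k/A_k$ for all $k$, it consists of the horizontal ray from $-\infty+i\varphi_1$ to $c+i\varphi_1$,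 the segment from $c+i\varphi_1$ to $c+i\varphi_2$ and the horizontal ray from $c+i\varphi_2$ to $-\infty+i\varphi_2$. Suppose that $\mu=0$, that $\rho\le 1$, and that $W$ (with removable singularities, if any, filled in) is completely monotonic on $(0,\infty)$, i.e. $W$ is smooth with values in $(0,\infty)$ and $(-1)^nW^{(n)}(x)\ge 0$ for all $x>0$, $n\ge 0$. Then, for every such loop $\mathcal L$, $H$ is real and nonnegative on $(0,\rho)$, and the representing measure of $W$ in Bernstein's theorem is $$d\nu(t)=\nu\,\delta_{-\log\rho}(t)+H(e^{-t})\,dt\quad\text{on }[-\log\rho,\infty),$$ where $\delta_w$ is the unit mass at $w$. That is, for all $x>0$ $$W(x)=\int_{[-\log\rho,\infty)}e^{-xt}\,d\nu(t)$$ with an absolutely convergent integral, and $d\nu$ is the only nonnegative measure on $[0,\infty)$ whose Laplace transform is $W$ on $(0,\infty)$. -/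

import Mathlib

open scoped ContDiff

namespace FoxH

noncomputable section

/-- The gamma ratio `∏ₖ Γ(Aₖ s + aₖ) / ∏ⱼ Γ(Bⱼ s + bⱼ)` of a complex variable. (Where a gamma
function in the denominator has a pole, Mathlib's value `0` for it and division by `0` give the
value `0`, which is the usual convention for `1/Γ`.) -/
def gammaRatioC {p q : ℕ} (A a : Fin p → ℝ) (B b : Fin q → ℝ) (s : ℂ) : ℂ :=
  (∏ k, Complex.Gamma ((A k : ℂ) * s + (a k : ℂ))) /
    ∏ j, Complex.Gamma ((B j : ℂ) * s + (b j : ℂ))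

/-- The gamma ratio `∏ₖ Γ(Aₖ x + aₖ) / ∏ⱼ Γ(Bⱼ x + bⱼ)` of a real variable. -/
def gammaRatio {p q : ℕ} (A a : Fin p → ℝ) (B b : Fin q → ℝ) (x : ℝ) : ℝ :=
  (∏ k, Real.Gamma (A k * x + a k)) / ∏ j, Real.Gamma (B j * x + b j)

/-- `ρ = ∏ₖ Aₖ ^ Aₖ * ∏ⱼ Bⱼ ^ (-Bⱼ)`. -/
def rho {p q : ℕ} (A : Fin p → ℝ) (B : Fin q → ℝ) : ℝ :=
  (∏ k, A k ^ A k) * ∏ j, B j ^ (-B j)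

/-- `μ = ∑ⱼ bⱼ - ∑ₖ aₖ + (p - q) / 2`. -/
def mu {p q : ℕ} (a : Fin p → ℝ) (b : Fin q → ℝ) : ℝ :=
  (∑ j, b j) - (∑ k, a k) + ((p : ℝ) - (q : ℝ)) / 2

/-- `ν = (2π) ^ ((p - q) / 2) * ∏ₖ Aₖ ^ (aₖ - 1/2) * ∏ⱼ Bⱼ ^ (1/2 - bⱼ)`. -/
def nu {p q : ℕ} (A a : Fin p → ℝ) (B b : Fin q → ℝ) : ℝ :=
  (2 * Real.pi) ^ (((p : ℝ) - (q : ℝ)) / 2) *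
    (∏ k, A k ^ (a k - 1 / 2)) * ∏ j, B j ^ (1 / 2 - b j)

/-- The integral `∫ f(s) ds` over the left loop which starts at `-∞ + i φ₁`, runs along a
horizontal ray to `c + i φ₁`, then along a vertical segment to `c + i φ₂`, and returns along a
horizontal ray to `-∞ + i φ₂`. -/
def leftLoopIntegral (c φ₁ φ₂ : ℝ) (f : ℂ → ℂ) : ℂ :=
  (∫ u in Set.Iic c, f ((u : ℂ) + (φ₁ : ℂ) * Complex.I)) +
    (∫ v in φ₁..φ₂, f ((c : ℂ) + (v : ℂ) * Complex.I) * Complex.I) -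
    ∫ u in Set.Iic c, f ((u : ℂ) + (φ₂ : ℂ) * Complex.I)

/-- Fox's function `H^{p,0}_{q,p}(x | (B, b); (A, a))` in the delta neutral case, for
`0 < x < ρ`: the Mellin-Barnes integral `(2πi)⁻¹ ∫_L ∏ₖ Γ(Aₖ s + aₖ) / ∏ⱼ Γ(Bⱼ s + bⱼ) x^{-s} ds`
over a left loop `L`. The loop leaves all the poles of the integrand, which are real and at most
`maxₖ (-aₖ / Aₖ)`, on its left when `φ₁ < 0 < φ₂` and `-aₖ / Aₖ < c` for all `k`; by Cauchy's
theorem the value is the same for all such `c`, `φ₁`, `φ₂`. -/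
def foxH (c φ₁ φ₂ : ℝ) {p q : ℕ} (A a : Fin p → ℝ) (B b : Fin q → ℝ) (x : ℝ) : ℂ :=
  (2 * (Real.pi : ℂ) * Complex.I)⁻¹ *
    leftLoopIntegral c φ₁ φ₂ fun s => gammaRatioC A a B b s * (x : ℂ) ^ (-s)

/-- `f` is completely monotonic on `(0, ∞)`, as a function with values in `(0, ∞)`. Only the
values of `f` on `(0, ∞)` matter. -/
def IsCompletelyMonotonic (f : ℝ → ℝ) : Prop :=
  (∀ x : ℝ, 0 < x → 0 < f x) ∧ ContDiffOn ℝ ∞ f (Set.Ioi 0) ∧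
    ∀ (n : ℕ) (x : ℝ), 0 < x → 0 ≤ (-1 : ℝ) ^ n * iteratedDeriv n f x

/-- The measure `ν δ_{-log ρ} + H(e^{-t}) dt` on `[-log ρ, ∞)`, regarded as a measure on `ℝ`
that vanishes outside that half-line. It is the intended measure when `H` is real and
nonnegative on `(0, ρ)`. -/
def reprMeasure (c φ₁ φ₂ : ℝ) {p q : ℕ} (A a : Fin p → ℝ) (B b : Fin q → ℝ) :
    MeasureTheory.Measure ℝ :=
  ENNReal.ofReal (nu A a B b) • MeasureTheory.Measure.dirac (-Real.log (rho A B)) +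
    (MeasureTheory.volume.restrict (Set.Ici (-Real.log (rho A B)))).withDensity
      fun t => ENNReal.ofReal (foxH c φ₁ φ₂ A a B b (Real.exp (-t))).re

end

end FoxH

/-! ### Stirling's formula on the slit plane, with a remainder that is uniform off the real axis. -/

namespace FoxH

open Complex Filter Topology Finset

/-! Write `G(s) = ρ^(-s) W(s) - ν`. In Stirling's formula for the gamma ratio, `∑ B = ∑ A` cancels
the terms in `s log s` and `s`, and `μ = 0` cancels the term in `log s`. Hence `G` is `O(1/|Im s|)`
away from the real axis, even far to the left, and `O(1/Re s)` far to the right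
(`exists_normRatio_eq`, `norm_normRatio_sub_nu_le`).

With `x = e^(-t)` and `l = t + log ρ`, the function `H` is the loop integral of `(G(s) + ν) e^(ls)`.
The constant `ν` contributes nothing by Cauchy's theorem, and the decay of `G` opens the loop into
the principal value integral over `Re s = c`. The Laplace transform of that integral is `G`, by
Fubini and Cauchy's formula for a half-plane (`laplace_loopTransform`). So `W(x) = ν ρ^x + ∫
H(e^(-t)) e^(-xt) dt`, but only for `x > c` (`laplace_foxH`).

Complete monotonicity does the rest. In the manner of Post and Widder, `(-1)^n W^(n)(x₀ + n/t₁)`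
integrates `H(e^(-t)) e^(-x₀t)` against `(t e^(-t/t₁))^n`, which concentrates at `t₁`; hence `H` is
real and nonnegative (`nonneg_of_laplace_iteratedDeriv`). Now a positive measure is available, and
Landau's argument with Taylor sums of positive terms makes its Laplace integral converge for all `x
> 0` (`integrable_exp_of_isCompletelyMonotonic`). The identity theorem carries the representation to
`(0, ∞)` (`eq_laplace_of_eq_gammaRatio`), and together with the injectivity of characteristic
functions it gives uniqueness (`measure_ext_of_laplace`). -/

/-- The general term of Gudermann's series for the remainder in Stirling's formula. -/
noncomputable def gudermannTerm (z : ℂ) : ℂ :=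
  (z + 1 / 2) * (log (z + 1) - log z) - 1

lemma add_ofReal_mem_slitPlane {z : ℂ} (hz : z ∈ slitPlane) {t : ℝ} (ht : 0 ≤ t) :
    z + t ∈ slitPlane := by
  rw [mem_slitPlane_iff] at hz ⊢
  rcases hz with h | h
  · left; simp; linarith
  · right; simpa using h

/-- The term is the error of the trapezoidal rule for `log` on `[z, z + 1]`, and `t(1 - t)/2` is the
Peano kernel of that rule. -/
lemma gudermannTerm_eq_integral {z : ℂ} (hz : z ∈ slitPlane) :
    gudermannTerm z = ∫ t in (0 : ℝ)..1, ((t : ℂ) * (1 - t) / 2) / (z + t) ^ 2 := by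
  have hs : ∀ t ∈ Set.uIcc (0 : ℝ) 1, z + t ∈ slitPlane := fun t ht =>
    add_ofReal_mem_slitPlane hz (by rw [Set.uIcc_of_le zero_le_one] at ht; exact ht.1)
  have key : ∀ t ∈ Set.uIcc (0 : ℝ) 1,
      HasDerivAt (fun t : ℝ => -((t : ℂ) * (1 - t) / 2) / (z + t) + (z + 1 / 2) * log (z + t) - t)
        (((t : ℂ) * (1 - t) / 2) / (z + t) ^ 2) t := by
    intro t ht
    have h0 : HasDerivAt (fun t : ℝ => (t : ℂ)) 1 t := (hasDerivAt_id _).comp_ofReal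
    have h1 : HasDerivAt (fun t : ℝ => z + t) 1 t := h0.const_add z
    have hne : z + t ≠ 0 := slitPlane_ne_zero (hs t ht)
    have h2 := h1.clog_real (hs t ht)
    have h3 := (((h0.mul (h0.const_sub 1)).div_const 2).neg).div h1 hne
    have h4 := (h3.add (h2.const_mul (z + 1 / 2))).sub h0
    refine h4.congr_deriv ?_
    simp only [Pi.neg_apply, Pi.mul_apply]
    field_simp
    ring
  rw [intervalIntegral.integral_eq_sub_of_hasDerivAt key]
  · simp [gudermannTerm]; ring
  · apply ContinuousOn.intervalIntegrable
    intro t ht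
    have hne : (z + t) ^ 2 ≠ 0 := pow_ne_zero _ (slitPlane_ne_zero (hs t ht))
    refine ContinuousAt.continuousWithinAt ?_
    exact ContinuousAt.div (by fun_prop) (by fun_prop) hne

/-- The Peano kernel is at most `1`. A bound by a difference of values of `P` is chosen because it
telescopes when `z` runs through `z + k`. -/
lemma norm_gudermannTerm_le {z : ℂ} (hz : z ∈ slitPlane) {P P' : ℝ → ℝ}
    (hP : ∀ t ∈ Set.Icc (0 : ℝ) 1, HasDerivAt P (P' t) t)
    (hc : ContinuousOn P' (Set.Icc 0 1))
    (hle : ∀ t ∈ Set.Icc (0 : ℝ) 1, (‖z + t‖ ^ 2)⁻¹ ≤ P' t) :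
    ‖gudermannTerm z‖ ≤ P 1 - P 0 := by
  have hu : Set.uIcc (0 : ℝ) 1 = Set.Icc 0 1 := Set.uIcc_of_le zero_le_one
  have hi : IntervalIntegrable P' MeasureTheory.volume 0 1 :=
    ContinuousOn.intervalIntegrable (by rwa [hu])
  rw [gudermannTerm_eq_integral hz,
    ← intervalIntegral.integral_eq_sub_of_hasDerivAt (by rwa [hu]) hi]
  refine intervalIntegral.norm_integral_le_of_norm_le zero_le_one ?_ hi
  refine Eventually.of_forall fun t ht => ?_
  have ht' : t ∈ Set.Icc (0 : ℝ) 1 := ⟨ht.1.le, ht.2⟩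
  refine le_trans ?_ (hle t ht')
  have : (t : ℂ) * (1 - t) / 2 = ((t * (1 - t) / 2 : ℝ) : ℂ) := by push_cast; ring
  rw [norm_div, norm_pow, this, norm_real, Real.norm_of_nonneg, ← one_div]
  · gcongr
    nlinarith [ht.1, ht.2, sq_nonneg (t - 1)]
  · have := mul_nonneg ht'.1 (sub_nonneg.2 ht'.2); positivity

/-- Keeping `|z + t|²` exact leads to an arctangent, whose total variation is `π` wherever `Re z`
lies. This is what makes the remainder small along rays going to `-∞`. -/
lemma norm_gudermannTerm_le_arctan {z : ℂ} (hz : z.im ≠ 0) :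
    ‖gudermannTerm z‖ ≤ |z.im|⁻¹ * Real.arctan ((z.re + 1) / |z.im|)
      - |z.im|⁻¹ * Real.arctan (z.re / |z.im|) := by
  have hy : 0 < |z.im| := abs_pos.2 hz
  have := norm_gudermannTerm_le (z := z) (by rw [mem_slitPlane_iff]; exact Or.inr hz)
    (P := fun t => |z.im|⁻¹ * Real.arctan ((z.re + t) / |z.im|))
    (P' := fun t => |z.im|⁻¹ * (1 / (1 + ((z.re + t) / |z.im|) ^ 2) * (1 / |z.im|))) ?_ ?_ ?_
  · simpa using this
  · intro t _
    exact ((((hasDerivAt_id t).const_add z.re).div_const _).arctan).const_mul _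
  · refine Continuous.continuousOn ?_
    have : ∀ t : ℝ, 1 + ((z.re + t) / |z.im|) ^ 2 ≠ 0 := fun t => by positivity
    fun_prop (disch := exact this _)
  · intro t _
    apply le_of_eq
    have h1 : ‖z + t‖ ^ 2 = (z.re + t) ^ 2 + |z.im| ^ 2 := by
      rw [← normSq_eq_norm_sq, normSq_apply]; simp [sq_abs]; ring
    rw [h1]
    field_simp
    ring

lemma norm_gudermannTerm_le_inv {z : ℂ} (hz : 0 < z.re) :
    ‖gudermannTerm z‖ ≤ (z.re)⁻¹ - (z.re + 1)⁻¹ := by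
  have := norm_gudermannTerm_le (z := z) (by rw [mem_slitPlane_iff]; exact Or.inl hz)
    (P := fun t => -(z.re + t)⁻¹)
    (P' := fun t => -(-1 / (z.re + t) ^ 2)) ?_ ?_ ?_
  · simpa [add_comm, sub_eq_add_neg] using this
  · intro t ht
    exact (((hasDerivAt_id t).const_add z.re).fun_inv (by simp only [id]; linarith [ht.1])).neg
  · intro t ht
    have : (z.re + t) ^ 2 ≠ 0 := by have := ht.1; positivity
    exact ContinuousAt.continuousWithinAt (by fun_prop (disch := assumption))
  · intro t ht
    have h0 := ht.1
    have h1 : ‖z + t‖ ^ 2 = (z.re + t) ^ 2 + z.im ^ 2 := by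
      rw [← normSq_eq_norm_sq, normSq_apply]; simp; ring
    rw [h1, neg_div', neg_neg, one_div]
    gcongr
    nlinarith [sq_nonneg z.im]

lemma sum_norm_gudermannTerm_le_im {z : ℂ} (hz : z.im ≠ 0) (n : ℕ) :
    ∑ k ∈ range n, ‖gudermannTerm (z + k)‖ ≤ Real.pi / |z.im| := by
  have hy : 0 < |z.im| := abs_pos.2 hz
  have h : ∑ k ∈ range n, ‖gudermannTerm (z + k)‖ ≤
      ∑ k ∈ range n, ((fun k : ℕ => |z.im|⁻¹ * Real.arctan ((z.re + k) / |z.im|)) (k + 1)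
      - (fun k : ℕ => |z.im|⁻¹ * Real.arctan ((z.re + k) / |z.im|)) k) := by
    refine sum_le_sum fun k _ => ?_
    have := norm_gudermannTerm_le_arctan (z := z + k) (by simpa using hz)
    simpa [add_assoc] using this
  refine h.trans ?_
  rw [sum_range_sub (fun k : ℕ => |z.im|⁻¹ * Real.arctan ((z.re + k) / |z.im|))]
  have h1 := (Real.arctan_lt_pi_div_two ((z.re + n) / |z.im|)).le
  have h2 := (Real.neg_pi_div_two_lt_arctan ((z.re + (0 : ℕ)) / |z.im|)).le
  rw [← mul_sub, div_eq_inv_mul Real.pi]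
  exact mul_le_mul_of_nonneg_left (by linarith) (by positivity)

lemma sum_norm_gudermannTerm_le_re {z : ℂ} (hz : 0 < z.re) (n : ℕ) :
    ∑ k ∈ range n, ‖gudermannTerm (z + k)‖ ≤ 1 / z.re := by
  have h : ∑ k ∈ range n, ‖gudermannTerm (z + k)‖ ≤
      ∑ k ∈ range n, ((fun k : ℕ => (z.re + k)⁻¹) k - (fun k : ℕ => (z.re + k)⁻¹) (k + 1)) := by
    refine sum_le_sum fun k _ => ?_
    have := norm_gudermannTerm_le_inv (z := z + k) (by simp; positivity)
    simpa [add_assoc] using this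
  refine h.trans ?_
  rw [sum_range_sub' (fun k : ℕ => (z.re + k)⁻¹)]
  have : 0 ≤ (z.re + n)⁻¹ := by positivity
  simp only [Nat.cast_zero, add_zero, one_div]
  linarith

lemma summable_norm_gudermannTerm {z : ℂ} (hz : z ∈ slitPlane) :
    Summable fun k : ℕ => ‖gudermannTerm (z + k)‖ := by
  rcases mem_slitPlane_iff.1 hz with h | h
  · exact summable_of_sum_range_le (fun _ => norm_nonneg _) (sum_norm_gudermannTerm_le_re h)
  · exact summable_of_sum_range_le (fun _ => norm_nonneg _) (sum_norm_gudermannTerm_le_im h)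

/-- Binet's function, the remainder in Stirling's formula for `log Γ`. -/
noncomputable def binet (z : ℂ) : ℂ := ∑' k : ℕ, gudermannTerm (z + k)

lemma norm_binet_le_im {z : ℂ} (hz : z.im ≠ 0) : ‖binet z‖ ≤ Real.pi / |z.im| :=
  (norm_tsum_le_tsum_norm (summable_norm_gudermannTerm (mem_slitPlane_iff.2 (Or.inr hz)))).trans
    (Real.tsum_le_of_sum_range_le (fun _ => norm_nonneg _) (sum_norm_gudermannTerm_le_im hz))

lemma norm_binet_le_re {z : ℂ} (hz : 0 < z.re) : ‖binet z‖ ≤ 1 / z.re :=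
  (norm_tsum_le_tsum_norm (summable_norm_gudermannTerm (mem_slitPlane_iff.2 (Or.inl hz)))).trans
    (Real.tsum_le_of_sum_range_le (fun _ => norm_nonneg _) (sum_norm_gudermannTerm_le_re hz))

lemma add_natCast_mem_slitPlane {z : ℂ} (hz : z ∈ slitPlane) (n : ℕ) : z + n ∈ slitPlane := by
  simpa using add_ofReal_mem_slitPlane hz (Nat.cast_nonneg (α := ℝ) n)

/-- Summation by parts. Only the principal logarithms of the separate `z + k` occur, so no branch of
the logarithm of the product has to be chosen. -/
lemma exp_sum_gudermannTerm {z : ℂ} (hz : z ∈ slitPlane) (n : ℕ) :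
    exp (∑ k ∈ range n, gudermannTerm (z + k)) * exp ((z - 1 / 2) * log z) *
      ∏ k ∈ range n, (z + k) = exp ((z + n - 1 / 2) * log (z + n) - n) := by
  have hprod : ∏ k ∈ range n, (z + k) = exp (∑ k ∈ range n, log (z + k)) := by
    rw [exp_sum]
    exact prod_congr rfl fun k _ =>
      (exp_log (slitPlane_ne_zero (add_natCast_mem_slitPlane hz k))).symm
  rw [hprod, ← exp_add, ← exp_add]
  congr 1
  induction n with
  | zero => simp
  | succ n ih =>
    rw [sum_range_succ, sum_range_succ]
    have := ih (by
      rw [exp_sum]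
      exact prod_congr rfl fun k _ =>
        (exp_log (slitPlane_ne_zero (add_natCast_mem_slitPlane hz k))).symm)
    push_cast
    rw [show z + ((n : ℂ) + 1) = z + n + 1 by ring]
    rw [gudermannTerm]
    linear_combination this

/-- In Euler's limit `n^z n! / ∏ (z + k)`, the factorial is expressed by `Stirling.stirlingSeq` and
the product by the Gudermann sum, which leaves three factors with known limits. -/
lemma GammaSeq_eq_stirling {z : ℂ} (hz : z ∈ slitPlane) {n : ℕ} (hn : 0 < n) :
    GammaSeq z n = (Stirling.stirlingSeq n * √2 : ℝ) *
      exp (1 - (z + n + 1 / 2) * (log (z + n + 1) - log n)) *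
      (exp ((z - 1 / 2) * log z) * exp (∑ k ∈ range (n + 1), gudermannTerm (z + k))) := by
  have hpr : ∏ k ∈ range (n + 1), (z + k) ≠ 0 :=
    prod_ne_zero_iff.2 fun k _ => slitPlane_ne_zero (add_natCast_mem_slitPlane hz k)
  have hn0 : (n : ℂ) ≠ 0 := by exact_mod_cast hn.ne'
  have hnR : (0 : ℝ) < n := by exact_mod_cast hn
  have hfact : ((n.factorial : ℝ)) =
      Stirling.stirlingSeq n * √2 * Real.exp ((n + 1 / 2) * Real.log n - n) := by
    have h1 : Real.exp ((n + 1 / 2) * Real.log n - n) = √n * (n / Real.exp 1) ^ n := by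
      rw [div_pow, ← Real.exp_nat_mul, mul_one, Real.exp_sub, add_mul, Real.exp_add,
        Real.exp_nat_mul, Real.exp_log hnR, Real.sqrt_eq_rpow, Real.rpow_def_of_pos hnR]
      ring_nf
    rw [h1, Stirling.stirlingSeq, Real.sqrt_mul (by norm_num)]
    have : √(n : ℝ) ≠ 0 := (Real.sqrt_pos.2 hnR).ne'
    have : √(2 : ℝ) ≠ 0 := by positivity
    field_simp
  have hfactC : (n.factorial : ℂ) =
      (Stirling.stirlingSeq n * √2 : ℝ) * exp ((n + 1 / 2) * log n - n) := by
    have : (n.factorial : ℂ) = ((n.factorial : ℝ) : ℂ) := by simp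
    rw [this, hfact]; push_cast; simp
  rw [GammaSeq, div_eq_iff hpr, hfactC, cpow_def_of_ne_zero hn0]
  have := exp_sum_gudermannTerm hz (n + 1)
  calc _ = (Stirling.stirlingSeq n * √2 : ℝ) *
        (exp (log n * z) * exp ((n + 1 / 2) * log n - n)) := by ring
    _ = (Stirling.stirlingSeq n * √2 : ℝ) *
        (exp (1 - (z + n + 1 / 2) * (log (z + n + 1) - log n)) *
        exp ((z + (n + 1 : ℕ) - 1 / 2) * log (z + (n + 1 : ℕ)) - (n + 1 : ℕ))) := by
      rw [← exp_add, ← exp_add]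
      congr 2
      push_cast
      rw [show z + ((n : ℂ) + 1) = z + n + 1 by ring]
      ring
    _ = _ := by rw [← this]; ring

lemma tendsto_mul_log_sub_log {z : ℂ} :
    Tendsto (fun n : ℕ => (z + n + 1 / 2) * (log (z + n + 1) - log n)) atTop (𝓝 (z + 1)) := by
  have hT : Tendsto (fun n : ℕ => (n : ℂ) * log (1 + (z + 1) / n)) atTop (𝓝 (z + 1)) := by
    refine tendsto_nat_mul_log_one_add_of_tendsto (tendsto_const_nhds.congr' ?_)
    filter_upwards [eventually_gt_atTop 0] with n hn
    have : (n : ℂ) ≠ 0 := by exact_mod_cast hn.ne'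
    field_simp
  have hinv : Tendsto (fun n : ℕ => 1 + (z + 1 / 2) * (n : ℂ)⁻¹) atTop (𝓝 1) := by
    have := (tendsto_inv_atTop_nhds_zero_nat (𝕜 := ℂ)).const_mul (z + 1 / 2)
    simpa using this.const_add 1
  have := hinv.mul hT
  rw [one_mul] at this
  refine this.congr' ?_
  have hlim : Tendsto (fun n : ℕ => 1 + (z + 1) * (n : ℂ)⁻¹) atTop (𝓝 1) := by
    have := (tendsto_inv_atTop_nhds_zero_nat (𝕜 := ℂ)).const_mul (z + 1)
    simpa using this.const_add 1
  filter_upwards [eventually_gt_atTop 0, hlim.eventually_ne one_ne_zero] with n hn hne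
  have hn0 : (n : ℂ) ≠ 0 := by exact_mod_cast hn.ne'
  have hnR : (0 : ℝ) < n := by exact_mod_cast hn
  have h1 : z + n + 1 = ((n : ℝ) : ℂ) * (1 + (z + 1) * (n : ℂ)⁻¹) := by
    push_cast; field_simp; ring
  rw [h1, log_ofReal_mul hnR hne, ofReal_log hnR.le, ofReal_natCast]
  field_simp
  ring

/-- Stirling's formula with Binet's remainder on the slit plane. -/
theorem Gamma_eq_exp_binet {z : ℂ} (hz : z ∈ slitPlane) :
    Gamma z = (√(2 * Real.pi) : ℝ) * exp ((z - 1 / 2) * log z - z + binet z) := by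
  have h1 : Tendsto (fun n : ℕ => ((Stirling.stirlingSeq n * √2 : ℝ) : ℂ)) atTop
      (𝓝 ((√(2 * Real.pi) : ℝ) : ℂ)) := by
    rw [mul_comm 2, Real.sqrt_mul Real.pi_pos.le]
    exact (continuous_ofReal.tendsto _).comp (Stirling.tendsto_stirlingSeq_sqrt_pi.mul_const _)
  have h2 : Tendsto (fun n : ℕ => exp (1 - (z + n + 1 / 2) * (log (z + n + 1) - log n))) atTop
      (𝓝 (exp (1 - (z + 1)))) :=
    (continuous_exp.tendsto _).comp (tendsto_mul_log_sub_log.const_sub 1)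
  have h3 : Tendsto (fun n : ℕ => exp (∑ k ∈ range (n + 1), gudermannTerm (z + k))) atTop
      (𝓝 (exp (binet z))) :=
    (continuous_exp.tendsto _).comp
      (((summable_norm_gudermannTerm hz).of_norm.hasSum.tendsto_sum_nat).comp
        (tendsto_add_atTop_nat 1))
  have h4 := (h1.mul h2).mul (h3.const_mul (exp ((z - 1 / 2) * log z)))
  have h5 := h4.congr' (f₂ := GammaSeq z) (by
    filter_upwards [eventually_gt_atTop 0] with n hn
    rw [GammaSeq_eq_stirling hz hn])
  rw [tendsto_nhds_unique (GammaSeq_tendsto_Gamma z) h5, mul_assoc, ← exp_add, ← exp_add]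
  congr 2
  ring

end FoxH

/-! ### Asymptotics of the gamma ratio. -/

namespace FoxH

open Complex Filter Topology Finset

/-- Mean value inequality along `s + t`. For the second bound, `s log(s + t) - t` has the derivative
`-t/(s + t)`. -/
lemma norm_log_shift_le {s : ℂ} {α d : ℝ} (hd : 0 < d)
    (h : ∀ t : ℝ, |t| ≤ |α| → s + t ∈ slitPlane ∧ d ≤ ‖s + t‖) :
    ‖log (s + α) - log s‖ ≤ |α| / d ∧ ‖s * (log (s + α) - log s) - α‖ ≤ α ^ 2 / d := by
  have hmem : ∀ t ∈ Set.uIcc 0 α, |t| ≤ |α| := fun t ht => by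
    have := Set.abs_sub_left_of_mem_uIcc ht
    simpa using this
  have h0 : ∀ t : ℝ, HasDerivAt (fun t : ℝ => (t : ℂ)) 1 t :=
    fun t => (hasDerivAt_id _).comp_ofReal
  have h1 : ∀ t ∈ Set.uIcc 0 α, HasDerivAt (fun t : ℝ => log (s + t)) (1 / (s + t)) t :=
    fun t ht => ((h0 t).const_add s).clog_real (h t (hmem t ht)).1
  constructor
  · have := (convex_uIcc (0 : ℝ) α).norm_image_sub_le_of_norm_hasDerivWithin_le (C := 1 / d)
      (fun t ht => (h1 t ht).hasDerivWithinAt) (fun t ht => by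
        rw [norm_div, norm_one]
        exact one_div_le_one_div_of_le hd (h t (hmem t ht)).2)
      Set.left_mem_uIcc Set.right_mem_uIcc
    simp only [ofReal_zero, add_zero, sub_zero, Real.norm_eq_abs] at this
    rwa [div_mul_eq_mul_div, one_mul] at this
  · have := (convex_uIcc (0 : ℝ) α).norm_image_sub_le_of_norm_hasDerivWithin_le (C := |α| / d)
      (f := fun t : ℝ => s * log (s + t) - t) (f' := fun t : ℝ => s * (1 / (s + t)) - 1)
      (fun t ht => (((h1 t ht).const_mul s).sub (h0 t)).hasDerivWithinAt) (fun t ht => by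
        have hne : s + t ≠ 0 := slitPlane_ne_zero (h t (hmem t ht)).1
        have : s * (1 / (s + t)) - 1 = -t / (s + t) := by field_simp; ring
        rw [this, norm_div, norm_neg, norm_real, Real.norm_eq_abs]
        exact div_le_div₀ (abs_nonneg _) (hmem t ht) hd (h t (hmem t ht)).2)
      Set.left_mem_uIcc Set.right_mem_uIcc
    simp only [ofReal_zero, add_zero, sub_zero, Real.norm_eq_abs] at this
    rw [div_mul_eq_mul_div, ← pow_two, sq_abs] at this
    have e : s * log (s + α) - α - s * log s = s * (log (s + α) - log s) - α := by ring
    rwa [e] at this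

/-- Stirling's formula for `Γ(A s + a)`, uniformly off the real axis and to the far right. -/
lemma exists_Gamma_affine_eq {A : ℝ} (hA : 0 < A) (a : ℝ) :
    ∃ (E : ℂ → ℂ) (C R : ℝ), 0 ≤ C ∧ 0 < R ∧
      ∀ (s : ℂ) (d : ℝ), 0 < d → (d ≤ |s.im| ∨ R ≤ s.re ∧ d ≤ s.re) →
        Gamma (A * s + a) = exp ((A * s + a - 1 / 2) * (Real.log A + log s) - A * s
          + (Real.log (2 * Real.pi) / 2 : ℝ) + E s) ∧ ‖E s‖ ≤ C / d := by
  set α : ℝ := a / A with hα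
  -- Factoring `A s + a = A (s + α)` splits the logarithm as `log A + log (s + α)`.
  have hAα : (A : ℂ) * α = a := by rw [← ofReal_mul, hα, mul_div_cancel₀ _ hA.ne']
  -- The error is Binet's remainder plus the cost of replacing `log (s + α)` by `log s`; the `-a`
  -- removes the limit `A α` of the latter. The choice of `R` ensures `Re (s + t) ≥ Re s / 2` for
  -- `|t| ≤ |α|`.
  refine ⟨fun s => binet (A * s + a) + (A * s + a - 1 / 2) * (log (s + α) - log s) - a,
    Real.pi / A + 2 * A * α ^ 2 + 2 * |a - 1 / 2| * |α|, 2 * |α| + 1, by positivity,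
    by positivity, fun s d hd hs => ?_⟩
  have hz : (A : ℂ) * s + a = A * (s + α) := by rw [mul_add, hAα]
  have hfar : ∀ t : ℝ, |t| ≤ |α| → s + t ∈ slitPlane ∧ d / 2 ≤ ‖s + t‖ := by
    intro t ht
    rcases hs with hs | ⟨hR, hs⟩
    · refine ⟨mem_slitPlane_iff.2 (Or.inr ?_), ?_⟩
      · simpa using abs_pos.1 (hd.trans_le hs)
      · have := abs_im_le_norm (s + t)
        simp only [add_im, ofReal_im, add_zero] at this
        linarith
    · have h1 := neg_abs_le t
      have h2 : s.re / 2 ≤ (s + t).re := by simp; linarith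
      refine ⟨mem_slitPlane_iff.2 (Or.inl (by linarith [abs_nonneg α])), ?_⟩
      have := re_le_norm (s + t)
      linarith
  have hslit : (A : ℂ) * s + a ∈ slitPlane := by
    rw [hz, mem_slitPlane_iff]
    have := mem_slitPlane_iff.1 (hfar α le_rfl).1
    rw [re_ofReal_mul, im_ofReal_mul]
    exact this.imp (fun h => mul_pos hA h) (fun h => mul_ne_zero hA.ne' h)
  have hb : ‖binet (A * s + a)‖ ≤ (Real.pi / A) / d := by
    rcases hs with hs | ⟨hR, hs⟩
    · have him : ((A : ℂ) * s + a).im = A * s.im := by simp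
      refine (norm_binet_le_im ?_).trans ?_
      · rw [him]; exact mul_ne_zero hA.ne' (abs_pos.1 (hd.trans_le hs))
      · rw [him, abs_mul, abs_of_pos hA, div_div]
        gcongr
    · have h2 : A * (s.re / 2) ≤ ((A : ℂ) * s + a).re := by
        rw [hz, re_ofReal_mul]
        gcongr
        simp; linarith [neg_abs_le α]
      have h3 : 0 < A * (s.re / 2) := mul_pos hA (by linarith)
      refine (norm_binet_le_re (h3.trans_le h2)).trans ?_
      rw [div_div]
      have h4 : A * d ≤ 2 * ((A : ℂ) * s + a).re := by nlinarith
      rw [div_le_div_iff₀ (h3.trans_le h2) (by positivity)]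
      nlinarith [Real.pi_gt_three]
  obtain ⟨hl1, hl2⟩ := norm_log_shift_le (half_pos hd) hfar
  constructor
  · rw [Gamma_eq_exp_binet hslit, Real.sqrt_eq_rpow, Real.rpow_def_of_pos (by positivity),
      ofReal_exp, ← exp_add]
    congr 1
    have hlog : log ((A : ℂ) * s + a) = Real.log A + log (s + α) := by
      rw [hz, log_ofReal_mul hA (slitPlane_ne_zero (hfar α le_rfl).1)]
    rw [hlog]
    push_cast
    ring
  · have : binet (A * s + a) + (A * s + a - 1 / 2) * (log (s + α) - log s) - a =
        binet (A * s + a) + A * (s * (log (s + α) - log s) - α)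
          + ((a - 1 / 2 : ℝ) : ℂ) * (log (s + α) - log s) := by
      push_cast; linear_combination hAα
    refine (congrArg norm this).trans_le ?_
    refine (norm_add₃_le).trans ?_
    rw [norm_mul, norm_mul, norm_real, norm_real, Real.norm_eq_abs, Real.norm_eq_abs, abs_of_pos hA]
    calc _ ≤ (Real.pi / A) / d + A * (α ^ 2 / (d / 2)) + |a - 1 / 2| * (|α| / (d / 2)) := by
          gcongr
      _ = _ := by field_simp

lemma rho_pos {p q : ℕ} {A : Fin p → ℝ} {B : Fin q → ℝ} (hA : ∀ k, 0 < A k) (hB : ∀ j, 0 < B j) :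
    0 < rho A B :=
  mul_pos (prod_pos fun k _ => Real.rpow_pos_of_pos (hA k) _)
    (prod_pos fun j _ => Real.rpow_pos_of_pos (hB j) _)

lemma nu_pos {p q : ℕ} {A : Fin p → ℝ} {B : Fin q → ℝ} (hA : ∀ k, 0 < A k) (hB : ∀ j, 0 < B j)
    (a : Fin p → ℝ) (b : Fin q → ℝ) : 0 < nu A a B b :=
  mul_pos (mul_pos (Real.rpow_pos_of_pos (by positivity) _)
    (prod_pos fun k _ => Real.rpow_pos_of_pos (hA k) _))
    (prod_pos fun j _ => Real.rpow_pos_of_pos (hB j) _)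

lemma log_rho {p q : ℕ} {A : Fin p → ℝ} {B : Fin q → ℝ} (hA : ∀ k, 0 < A k) (hB : ∀ j, 0 < B j) :
    Real.log (rho A B) = ∑ k, A k * Real.log (A k) - ∑ j, B j * Real.log (B j) := by
  have h1 : ∀ k, A k ^ A k ≠ 0 := fun k => (Real.rpow_pos_of_pos (hA k) _).ne'
  have h2 : ∀ j, B j ^ (-B j) ≠ 0 := fun j => (Real.rpow_pos_of_pos (hB j) _).ne'
  rw [rho, Real.log_mul (prod_ne_zero_iff.2 fun k _ => h1 k) (prod_ne_zero_iff.2 fun j _ => h2 j),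
    Real.log_prod (fun k _ => h1 k), Real.log_prod (fun j _ => h2 j)]
  simp_rw [Real.log_rpow (hA _), Real.log_rpow (hB _), neg_mul, sum_neg_distrib]
  ring

lemma log_nu {p q : ℕ} {A : Fin p → ℝ} {B : Fin q → ℝ} (hA : ∀ k, 0 < A k) (hB : ∀ j, 0 < B j)
    (a : Fin p → ℝ) (b : Fin q → ℝ) :
    Real.log (nu A a B b) = ((p : ℝ) - q) / 2 * Real.log (2 * Real.pi) +
      ∑ k, (a k - 1 / 2) * Real.log (A k) - ∑ j, (b j - 1 / 2) * Real.log (B j) := by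
  have h1 : ∀ k, A k ^ (a k - 1 / 2) ≠ 0 := fun k => (Real.rpow_pos_of_pos (hA k) _).ne'
  have h2 : ∀ j, B j ^ (1 / 2 - b j) ≠ 0 := fun j => (Real.rpow_pos_of_pos (hB j) _).ne'
  have h3 : (2 * Real.pi) ^ (((p : ℝ) - q) / 2) ≠ 0 :=
    (Real.rpow_pos_of_pos (by positivity) _).ne'
  have h4 : ∏ k, A k ^ (a k - 1 / 2) ≠ 0 := prod_ne_zero_iff.2 fun k _ => h1 k
  rw [nu, Real.log_mul (mul_ne_zero h3 h4) (prod_ne_zero_iff.2 fun j _ => h2 j),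
    Real.log_mul h3 h4, Real.log_rpow (by positivity),
    Real.log_prod (fun k _ => h1 k), Real.log_prod (fun j _ => h2 j)]
  simp_rw [Real.log_rpow (hA _), Real.log_rpow (hB _)]
  have : ∑ j, (1 / 2 - b j) * Real.log (B j) = -∑ j, (b j - 1 / 2) * Real.log (B j) := by
    rw [← sum_neg_distrib]; exact sum_congr rfl fun j _ => by ring
  rw [this]; ring

/-- The gamma ratio, divided by the exponential factor `ρ ^ s` of its asymptotics. -/
noncomputable def normRatio {p q : ℕ} (A a : Fin p → ℝ) (B b : Fin q → ℝ) (s : ℂ) : ℂ :=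
  gammaRatioC A a B b s * exp (-(s * Real.log (rho A B)))

lemma exists_prod_Gamma_affine_eq {p : ℕ} {A : Fin p → ℝ} (hA : ∀ k, 0 < A k) (a : Fin p → ℝ) :
    ∃ (E : ℂ → ℂ) (C R : ℝ), 0 ≤ C ∧ 0 < R ∧
      ∀ (s : ℂ) (d : ℝ), 0 < d → (d ≤ |s.im| ∨ R ≤ s.re ∧ d ≤ s.re) →
        ∏ k, Gamma (A k * s + a k) = exp (s * (∑ k, A k * Real.log (A k) : ℝ)
          + (∑ k, (a k - 1 / 2) * Real.log (A k) : ℝ)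
          + (s * (∑ k, A k : ℝ) + ((∑ k, a k : ℝ) - p / 2)) * log s - s * (∑ k, A k : ℝ)
          + p * (Real.log (2 * Real.pi) / 2 : ℝ) + E s) ∧ ‖E s‖ ≤ C / d := by
  choose E C R hC hR h using fun k => exists_Gamma_affine_eq (hA k) (a k)
  refine ⟨fun s => ∑ k, E k s, ∑ k, C k, 1 + ∑ k, R k, sum_nonneg fun k _ => hC k,
    by have := sum_nonneg fun k (_ : k ∈ univ) => (hR k).le; linarith, fun s d hd hs => ?_⟩
  have h' := fun k => h k s d hd (hs.imp_right fun hs => ⟨by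
    have := single_le_sum (fun k _ => (hR k).le) (mem_univ k)
    linarith [hs.1], hs.2⟩)
  constructor
  · rw [prod_congr rfl fun k _ => (h' k).1, ← exp_sum]
    congr 1
    -- The exponents are sorted into the coefficients of `s`, `s log s`, `log s` and `1`, the form
    -- in which numerator and denominator cancel later.
    have key : ∀ S : Finset (Fin p), ∑ k ∈ S, ((A k * s + a k - 1 / 2) * (Real.log (A k) + log s)
        - A k * s + (Real.log (2 * Real.pi) / 2 : ℝ) + E k s) =
        s * (∑ k ∈ S, A k * Real.log (A k) : ℝ) + (∑ k ∈ S, (a k - 1 / 2) * Real.log (A k) : ℝ)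
          + (s * (∑ k ∈ S, A k : ℝ) + ((∑ k ∈ S, a k : ℝ) - (S.card : ℂ) / 2)) * log s
          - s * (∑ k ∈ S, A k : ℝ) + S.card * (Real.log (2 * Real.pi) / 2 : ℝ)
          + ∑ k ∈ S, E k s := by
      intro S
      induction S using Finset.induction_on with
      | empty => simp
      | insert k S hk ih =>
        simp only [sum_insert hk, card_insert_of_notMem hk, ih]
        push_cast
        ring
    simpa using key univ
  · refine (norm_sum_le _ _).trans ?_
    rw [sum_div]
    exact sum_le_sum fun k _ => (h' k).2

/-- All growing terms cancel: `hΔ` removes those with `∑ A` and `∑ B`, `hμ` the multiple of `log s`,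
and the factor `ρ^(-s)` the remaining linear term. The constants that are left add up to `log ν`. -/
lemma exists_normRatio_eq {p q : ℕ} {A a : Fin p → ℝ} {B b : Fin q → ℝ}
    (hA : ∀ k, 0 < A k) (hB : ∀ j, 0 < B j) (hΔ : (∑ j, B j) - (∑ k, A k) = 0)
    (hμ : mu a b = 0) :
    ∃ (E : ℂ → ℂ) (C R : ℝ), 0 ≤ C ∧ 0 < R ∧
      ∀ (s : ℂ) (d : ℝ), 0 < d → (d ≤ |s.im| ∨ R ≤ s.re ∧ d ≤ s.re) →
        normRatio A a B b s = nu A a B b * exp (E s) ∧ ‖E s‖ ≤ C / d := by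
  obtain ⟨E₁, C₁, R₁, hC₁, hR₁, h₁⟩ := exists_prod_Gamma_affine_eq hA a
  obtain ⟨E₂, C₂, R₂, hC₂, hR₂, h₂⟩ := exists_prod_Gamma_affine_eq hB b
  refine ⟨fun s => E₁ s - E₂ s, C₁ + C₂, R₁ + R₂, by positivity, by positivity,
    fun s d hd hs => ?_⟩
  obtain ⟨e₁, b₁⟩ := h₁ s d hd (hs.imp_right fun hs => ⟨by linarith [hs.1], hs.2⟩)
  obtain ⟨e₂, b₂⟩ := h₂ s d hd (hs.imp_right fun hs => ⟨by linarith [hs.1], hs.2⟩)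
  constructor
  · have hν : (nu A a B b : ℂ) = exp (Real.log (nu A a B b)) := by
      rw [← ofReal_exp, Real.exp_log (nu_pos hA hB a b)]
    rw [normRatio, gammaRatioC, e₁, e₂, hν, ← exp_sub, ← exp_add, ← exp_add, log_nu hA hB,
      log_rho hA hB]
    congr 1
    have hs1 : ((∑ j, B j : ℝ) : ℂ) = (∑ k, A k : ℝ) := by rw [sub_eq_zero.1 hΔ]
    have hs2 : ((∑ k, a k : ℝ) : ℂ) = (∑ j, b j : ℝ) + ((p : ℂ) - q) / 2 := by
      have : ∑ k, a k = ∑ j, b j + ((p : ℝ) - q) / 2 := by rw [mu] at hμ; linarith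
      rw [this]; push_cast; ring
    rw [hs1, hs2]
    push_cast
    ring
  · rw [add_div]
    exact (norm_sub_le _ _).trans (add_le_add b₁ b₂)

/-- From `|e^w - 1| ≤ |w| e^|w|`; the lower bound `d₀` on `d` makes the exponential factor a
constant. -/
lemma norm_normRatio_sub_nu_le {p q : ℕ} {A a : Fin p → ℝ} {B b : Fin q → ℝ}
    (hA : ∀ k, 0 < A k) (hB : ∀ j, 0 < B j) (hΔ : (∑ j, B j) - (∑ k, A k) = 0)
    (hμ : mu a b = 0) {d₀ : ℝ} (hd₀ : 0 < d₀) :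
    ∃ C R : ℝ, 0 ≤ C ∧ 0 < R ∧
      ∀ (s : ℂ) (d : ℝ), d₀ ≤ d → (d ≤ |s.im| ∨ R ≤ s.re ∧ d ≤ s.re) →
        ‖normRatio A a B b s - nu A a B b‖ ≤ C / d := by
  obtain ⟨E, C, R, hC, hR, h⟩ := exists_normRatio_eq hA hB hΔ hμ
  refine ⟨nu A a B b * (C * Real.exp (C / d₀)), R,
    mul_nonneg (nu_pos hA hB a b).le (by positivity), hR, fun s d hd hs => ?_⟩
  have hd' : 0 < d := hd₀.trans_le hd
  obtain ⟨e, hE⟩ := h s d hd' hs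
  have h1 : ‖exp (E s) - 1‖ ≤ ‖E s‖ * Real.exp ‖E s‖ := by
    simpa using norm_exp_sub_sum_le_norm_mul_exp (E s) 1
  have h2 : ‖E s‖ ≤ C / d₀ := hE.trans (by gcongr)
  rw [e, show (nu A a B b : ℂ) * exp (E s) - nu A a B b = nu A a B b * (exp (E s) - 1) by ring,
    norm_mul, norm_real, Real.norm_of_nonneg (nu_pos hA hB a b).le, mul_div_assoc]
  refine mul_le_mul_of_nonneg_left (h1.trans ?_) (nu_pos hA hB a b).le
  calc _ ≤ C / d * Real.exp (C / d₀) := by gcongr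
    _ = _ := by ring

end FoxH

/-! ### Cauchy's theorem in half-strips and Cauchy's formula in half-planes. -/

namespace FoxH

open Complex Filter Topology MeasureTheory

lemma continuousOn_horizontal {f : ℂ → ℂ} {c y : ℝ}
    (hf : ∀ u ≤ c, ContinuousAt f ((u : ℂ) + (y : ℂ) * I)) :
    ContinuousOn (fun u : ℝ => f ((u : ℂ) + (y : ℂ) * I)) (Set.Iic c) := fun u hu =>
  (ContinuousAt.comp (g := f) (f := fun u : ℝ => (u : ℂ) + (y : ℂ) * I) (hf u hu)
    (by fun_prop)).continuousWithinAt

lemma integrableOn_horizontal {f : ℂ → ℂ} {c y M l : ℝ} (hl : 0 < l)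
    (hf : ∀ u ≤ c, ContinuousAt f ((u : ℂ) + (y : ℂ) * I))
    (hM : ∀ u ≤ c, ‖f ((u : ℂ) + (y : ℂ) * I)‖ ≤ M * Real.exp (l * u)) :
    IntegrableOn (fun u : ℝ => f ((u : ℂ) + (y : ℂ) * I)) (Set.Iic c) :=
  Integrable.mono' ((integrableOn_exp_mul_Iic hl c).const_mul M)
    ((continuousOn_horizontal hf).aestronglyMeasurable measurableSet_Iic)
    ((ae_restrict_iff' measurableSet_Iic).2 (Eventually.of_forall hM))

lemma norm_integral_horizontal_le {f : ℂ → ℂ} {c y M l : ℝ} (hl : 0 < l)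
    (hM : ∀ u ≤ c, ‖f ((u : ℂ) + (y : ℂ) * I)‖ ≤ M * Real.exp (l * u)) :
    ‖∫ u in Set.Iic c, f ((u : ℂ) + (y : ℂ) * I)‖ ≤ M * (Real.exp (l * c) / l) := by
  rw [← integral_exp_mul_Iic hl, ← integral_const_mul]
  exact norm_integral_le_of_norm_le ((integrableOn_exp_mul_Iic hl c).const_mul M)
    ((ae_restrict_iff' measurableSet_Iic).2 (Eventually.of_forall hM))

/-- Cauchy's theorem for a left half-strip. -/
lemma leftLoopIntegral_eq_zero {f : ℂ → ℂ} {c y₁ y₂ M l : ℝ} (hl : 0 < l) (hy : y₁ ≤ y₂)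
    (hf : ∀ s : ℂ, s.re ≤ c → y₁ ≤ s.im → s.im ≤ y₂ → DifferentiableAt ℂ f s)
    (hM : ∀ s : ℂ, s.re ≤ c → y₁ ≤ s.im → s.im ≤ y₂ → ‖f s‖ ≤ M * Real.exp (l * s.re)) :
    leftLoopIntegral c y₁ y₂ f = 0 := by
  have hint : ∀ y : ℝ, y₁ ≤ y → y ≤ y₂ →
      IntegrableOn (fun u : ℝ => f ((u : ℂ) + (y : ℂ) * I)) (Set.Iic c) := fun y h1 h2 =>
    integrableOn_horizontal hl
      (fun u hu => (hf _ (by simpa using hu) (by simpa using h1) (by simpa using h2)).continuousAt)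
      (fun u hu => by
        simpa using hM ((u : ℂ) + (y : ℂ) * I) (by simpa using hu) (by simpa using h1)
          (by simpa using h2))
  have hbot : Tendsto (fun n : ℕ => -(n : ℝ)) atTop atBot :=
    tendsto_neg_atTop_atBot.comp tendsto_natCast_atTop_atTop
  have t1 := intervalIntegral_tendsto_integral_Iic c (hint y₁ le_rfl hy) hbot
  have t2 := intervalIntegral_tendsto_integral_Iic c (hint y₂ hy le_rfl) hbot
  -- The left edge of the rectangle has fixed length and the integrand on it decays like `e^(-ln)`.
  have t3 : Tendsto (fun n : ℕ => I • ∫ y in y₁..y₂, f (((-(n : ℝ) : ℝ) : ℂ) + y * I)) atTop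
      (𝓝 0) := by
    have hz : Tendsto (fun n : ℕ => M * Real.exp (l * -(n : ℝ)) * |y₂ - y₁|) atTop (𝓝 0) := by
      have h1 : Tendsto (fun n : ℕ => l * -(n : ℝ)) atTop atBot := hbot.const_mul_atBot hl
      simpa using ((Real.tendsto_exp_atBot.comp h1).const_mul M).mul_const |y₂ - y₁|
    refine squeeze_zero_norm' ?_ hz
    filter_upwards [hbot.eventually_le_atBot c] with n hn
    rw [norm_smul, norm_I, one_mul]
    refine intervalIntegral.norm_integral_le_of_norm_le_const fun y hy' => ?_
    rw [Set.uIoc_of_le hy] at hy'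
    simpa using hM (((-(n : ℝ) : ℝ) : ℂ) + y * I) (by simpa using hn) (by simpa using hy'.1.le)
      (by simpa using hy'.2)
  have hlim := ((t1.sub t2).add_const (I • ∫ y in y₁..y₂, f ((c : ℂ) + y * I))).sub t3
  have hzero : ∀ᶠ n : ℕ in atTop, (((∫ x in (-(n : ℝ))..c, f (x + (y₁ : ℂ) * I)) -
      ∫ x in (-(n : ℝ))..c, f (x + (y₂ : ℂ) * I)) + I • ∫ y in y₁..y₂, f ((c : ℂ) + y * I)) -
      I • ∫ y in y₁..y₂, f (((-(n : ℝ) : ℝ) : ℂ) + y * I) = 0 := by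
    filter_upwards [hbot.eventually_le_atBot c] with n hn
    have := integral_boundary_rect_eq_zero_of_differentiableOn f
      ((-(n : ℝ) : ℝ) + y₁ * I) (c + y₂ * I) (fun s hs => by
        rw [mem_reProdIm] at hs
        simp only [add_re, ofReal_re, mul_re, I_re, mul_zero, ofReal_im, I_im, mul_one, sub_self,
          add_zero, add_im, mul_im, zero_add] at hs
        rw [Set.uIcc_of_le hn, Set.uIcc_of_le hy] at hs
        exact (hf s hs.1.2 hs.2.1 hs.2.2).differentiableWithinAt)
    simpa using this
  have := tendsto_nhds_unique (hlim.congr' hzero) tendsto_const_nhds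
  rw [leftLoopIntegral, intervalIntegral.integral_mul_const]
  rw [sub_zero, smul_eq_mul] at this
  linear_combination this

/-- The common ray is traversed in both directions. -/
lemma leftLoopIntegral_add_adjacent {f : ℂ → ℂ} {c y₁ y₂ y₃ : ℝ}
    (hf : Continuous fun v : ℝ => f ((c : ℂ) + (v : ℂ) * I)) :
    leftLoopIntegral c y₁ y₂ f + leftLoopIntegral c y₂ y₃ f = leftLoopIntegral c y₁ y₃ f := by
  have hc : Continuous fun v : ℝ => f ((c : ℂ) + (v : ℂ) * I) * I := hf.mul continuous_const
  rw [leftLoopIntegral, leftLoopIntegral, leftLoopIntegral,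
    ← intervalIntegral.integral_add_adjacent_intervals (hc.intervalIntegrable y₁ y₂)
      (hc.intervalIntegrable y₂ y₃)]
  ring

/-- If a holomorphic function on a right half-plane is `O(T ^ (-2))` on the sides of the
rectangles `[c, T] × [-T, T]`, its principal value integral over the edge vanishes. -/
lemma tendsto_integral_vertical_zero {Q : ℂ → ℂ} {c M T₀ : ℝ}
    (hQ : ∀ s : ℂ, c ≤ s.re → DifferentiableAt ℂ Q s)
    (hM : ∀ T : ℝ, T₀ ≤ T → ∀ s : ℂ, c ≤ s.re → (|s.im| = T ∨ s.re = T) → ‖Q s‖ ≤ M / T ^ 2) :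
    Tendsto (fun n : ℕ => ∫ v in (-(n : ℝ))..n, Q ((c : ℂ) + (v : ℂ) * I)) atTop (𝓝 0) := by
  -- The three other edges have length at most `2n`, with integrand at most `M / n²`.
  have hz : Tendsto (fun n : ℕ => 6 * M * ((n : ℝ)⁻¹)) atTop (𝓝 0) := by
    simpa using (tendsto_inv_atTop_nhds_zero_nat (𝕜 := ℝ)).const_mul (6 * M)
  refine squeeze_zero_norm' ?_ hz
  have htop := tendsto_natCast_atTop_atTop (R := ℝ)
  filter_upwards [htop.eventually_ge_atTop T₀, htop.eventually_ge_atTop |c|,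
    eventually_gt_atTop 0] with n hn hcn hpos
  have hnp : (0 : ℝ) < n := by exact_mod_cast hpos
  have hcn' : c ≤ n := (le_abs_self c).trans hcn
  have hM0 : 0 ≤ M / (n : ℝ) ^ 2 := (norm_nonneg _).trans (hM n hn (n : ℝ) (by simpa) (by simp))
  have hrect := integral_boundary_rect_eq_zero_of_differentiableOn Q
      (c + (-(n : ℝ) : ℝ) * I) ((n : ℝ) + (n : ℝ) * I) (fun s hs => by
        rw [mem_reProdIm] at hs
        simp only [add_re, ofReal_re, mul_re, I_re, mul_zero, ofReal_im, I_im, mul_one, sub_self,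
          add_zero, add_im, mul_im, zero_add] at hs
        rw [Set.uIcc_of_le hcn'] at hs
        exact (hQ s hs.1.1).differentiableWithinAt)
  simp only [add_re, ofReal_re, mul_re, I_re, mul_zero, ofReal_im, I_im, mul_one, sub_self,
          add_zero, add_im, mul_im, zero_add, smul_eq_mul] at hrect
  have b1 : ‖∫ x in c..(n : ℝ), Q (x + ((-(n : ℝ) : ℝ) : ℂ) * I)‖ ≤ M / (n : ℝ) ^ 2 * |n - c| :=
    intervalIntegral.norm_integral_le_of_norm_le_const fun x hx => by
      rw [Set.uIoc_of_le hcn'] at hx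
      exact hM n hn _ (by simpa using hx.1.le) (by simp)
  have b2 : ‖∫ x in c..(n : ℝ), Q (x + ((n : ℝ) : ℂ) * I)‖ ≤ M / (n : ℝ) ^ 2 * |n - c| :=
    intervalIntegral.norm_integral_le_of_norm_le_const fun x hx => by
      rw [Set.uIoc_of_le hcn'] at hx
      exact hM n hn _ (by simpa using hx.1.le) (by simp)
  have b3 : ‖∫ y in (-(n : ℝ))..n, Q (((n : ℝ) : ℂ) + y * I)‖ ≤
      M / (n : ℝ) ^ 2 * |(n : ℝ) - -n| :=
    intervalIntegral.norm_integral_le_of_norm_le_const fun y _ =>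
      hM n hn _ (by simpa using hcn') (by simp)
  have hlen : |(n : ℝ) - c| ≤ 2 * n := by
    rw [abs_of_nonneg (by linarith)]; linarith [neg_abs_le c]
  have hlen' : |(n : ℝ) - -n| = 2 * n := by rw [sub_neg_eq_add, abs_of_pos (by linarith)]; ring
  have hnorm : ‖∫ v in (-(n : ℝ))..n, Q ((c : ℂ) + (v : ℂ) * I)‖ =
      ‖(∫ x in c..(n : ℝ), Q (x + ((-(n : ℝ) : ℝ) : ℂ) * I))
        - (∫ x in c..(n : ℝ), Q (x + ((n : ℝ) : ℂ) * I))
        + I * ∫ y in (-(n : ℝ))..n, Q (((n : ℝ) : ℂ) + y * I)‖ := by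
    rw [sub_eq_zero.1 hrect, norm_mul, norm_I, one_mul]
  rw [hnorm]
  refine (norm_add_le _ _).trans ((add_le_add_left (norm_sub_le _ _) _).trans ?_)
  rw [norm_mul, norm_I, one_mul]
  calc _ ≤ M / (n : ℝ) ^ 2 * (2 * n) + M / (n : ℝ) ^ 2 * (2 * n) + M / (n : ℝ) ^ 2 * (2 * n) := by
        rw [hlen'] at b3
        exact add_le_add (add_le_add (b1.trans (by gcongr)) (b2.trans (by gcongr))) b3
    _ = _ := by field_simp; ring

lemma tendsto_integral_poisson {d : ℝ} (hd : 0 < d) :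
    Tendsto (fun n : ℕ => ∫ v in (-(n : ℝ))..n, 2 * d / (d ^ 2 + v ^ 2)) atTop
      (𝓝 (2 * Real.pi)) := by
  have hder : ∀ v : ℝ, HasDerivAt (fun v : ℝ => 2 * Real.arctan (v / d)) (2 * d / (d ^ 2 + v ^ 2))
      v := fun v => by
    have := (((hasDerivAt_id v).div_const d).arctan).const_mul 2
    refine this.congr_deriv ?_
    have : 1 + (v / d) ^ 2 ≠ 0 := by positivity
    simp only [id]
    field_simp
  have hcont : Continuous fun v : ℝ => 2 * d / (d ^ 2 + v ^ 2) := by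
    have : ∀ v : ℝ, d ^ 2 + v ^ 2 ≠ 0 := fun v => by positivity
    fun_prop (disch := exact this _)
  have heq : ∀ n : ℕ, ∫ v in (-(n : ℝ))..n, 2 * d / (d ^ 2 + v ^ 2) =
      4 * Real.arctan (n / d) := fun n => by
    rw [intervalIntegral.integral_eq_sub_of_hasDerivAt (fun v _ => hder v)
      (hcont.intervalIntegrable _ _), neg_div, Real.arctan_neg]
    ring
  simp_rw [heq]
  have h1 : Tendsto (fun n : ℕ => (n : ℝ) / d) atTop atTop :=
    tendsto_natCast_atTop_atTop.atTop_div_const hd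
  have h2 := ((Real.tendsto_arctan_atTop.mono_right nhdsWithin_le_nhds).comp h1).const_mul 4
  rwa [show 4 * (Real.pi / 2) = 2 * Real.pi by ring] at h2

/-- Cauchy's integral formula for a right half-plane and a function that is `O(1/T)` on the sides
of the rectangles `[c, T] × [-T, T]`. -/
lemma tendsto_integral_cauchy_halfPlane {G : ℂ → ℂ} {c C T₀ x : ℝ}
    (hG : ∀ s : ℂ, c ≤ s.re → DifferentiableAt ℂ G s)
    (hC : ∀ T : ℝ, T₀ ≤ T → ∀ s : ℂ, c ≤ s.re → (|s.im| = T ∨ s.re = T) → ‖G s‖ ≤ C / T)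
    (hx : c < x) :
    Tendsto (fun n : ℕ => ∫ v in (-(n : ℝ))..n,
      G ((c : ℂ) + (v : ℂ) * I) / (x - ((c : ℂ) + (v : ℂ) * I))) atTop
      (𝓝 (2 * Real.pi * G x)) := by
  -- The point `x'` is the reflection of `x` in the line `Re s = c`, so `1/(x' - s)` is holomorphic
  -- on the half-plane. The integrand is split as `G/(x' - s)`, plus `2d/(x' - s)` times the
  -- difference quotient of `G` at `x`, plus `G(x)` times the Poisson kernel. The first two are
  -- holomorphic and `O(T^(-2))`; the third integrates to `2π G(x)`.
  set x' : ℝ := 2 * c - x with hx'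
  set d : ℝ := x - c with hd
  have hdpos : 0 < d := sub_pos.2 hx
  -- Large enough that the sides of the rectangle stay at distance at least `T/2` from `x` and `x'`.
  set T₁ : ℝ := max (max T₀ 1) (2 * |x| + 2 * |x'|) with hT₁
  have hne' : ∀ s : ℂ, c ≤ s.re → (x' : ℂ) - s ≠ 0 := fun s hs h => by
    have := congrArg re h
    simp at this
    linarith
  have hlow : ∀ (y : ℝ), 2 * |y| ≤ T₁ → ∀ T : ℝ, T₁ ≤ T → ∀ s : ℂ, (|s.im| = T ∨ s.re = T) →
      T / 2 ≤ ‖(y : ℂ) - s‖ := by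
    intro y hy T hT s hs
    have hT0 : 0 ≤ T := by linarith [abs_nonneg y]
    rcases hs with hs | hs
    · have := abs_im_le_norm ((y : ℂ) - s)
      simp only [sub_im, ofReal_im, zero_sub, abs_neg, hs] at this
      linarith
    · have := abs_re_le_norm ((y : ℂ) - s)
      simp only [sub_re, ofReal_re, hs] at this
      have h2 := neg_abs_le (y - T)
      have h3 := le_abs_self y
      linarith
  have hlx : 2 * |x| ≤ T₁ := le_trans (by linarith [abs_nonneg x']) (le_max_right _ _)
  have hlx' : 2 * |x'| ≤ T₁ := le_trans (by linarith [abs_nonneg x]) (le_max_right _ _)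
  have hT₁1 : 1 ≤ T₁ := (le_max_right _ _).trans (le_max_left _ _)
  have hT₁0 : T₀ ≤ T₁ := (le_max_left _ _).trans (le_max_left _ _)
  have hC0 : 0 ≤ C := by
    have h1 : T₁ ≤ max T₁ c := le_max_left _ _
    have := (norm_nonneg _).trans
      (hC (max T₁ c) (hT₁0.trans h1) ((max T₁ c : ℝ) : ℂ) (by simp) (by simp))
    have h2 : 0 < max T₁ c := by linarith
    by_contra hneg
    exact absurd this (not_le.2 (div_neg_of_neg_of_pos (not_le.1 hneg) h2))
  have k1 := tendsto_integral_vertical_zero (Q := fun s => G s / (x' - s)) (c := c) (M := 2 * C)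
    (T₀ := T₁)
    (fun s hs => (hG s hs).div (by fun_prop) (hne' s hs)) (fun T hT s hs hsT => by
      have h1 := hC T (hT₁0.trans hT) s hs hsT
      have h2 := hlow x' hlx' T hT s hsT
      have hT0 : 0 < T := by linarith
      rw [norm_div]
      calc _ ≤ (C / T) / (T / 2) := by gcongr
        _ = _ := by field_simp)
  have hdsl : ∀ s : ℂ, c ≤ s.re → DifferentiableAt ℂ (dslope G x) s := by
    intro s hs
    by_cases hsx : s = x
    · have hU : {s : ℂ | c < s.re} ∈ 𝓝 (x : ℂ) :=
        (isOpen_lt continuous_const continuous_re).mem_nhds (by simpa using hx)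
      rw [hsx]
      exact ((differentiableOn_dslope hU).2 fun s hs =>
        (hG s (le_of_lt hs)).differentiableWithinAt).differentiableAt hU
    · exact (differentiableAt_dslope_of_ne hsx).2 (hG s hs)
  have k2 := tendsto_integral_vertical_zero (Q := fun s => dslope G x s * (2 * d / (x' - s)))
    (c := c) (M := 8 * d * (C + ‖G x‖)) (T₀ := T₁)
    (fun s hs => (hdsl s hs).mul ((differentiableAt_const _).div (by fun_prop) (hne' s hs)))
    (fun T hT s hs hsT => by
      have h1 := hC T (hT₁0.trans hT) s hs hsT
      have h2 := hlow x' hlx' T hT s hsT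
      have h3 := hlow x hlx T hT s hsT
      have hT0 : 1 ≤ T := by linarith
      have hsx : s ≠ x := by
        rintro rfl
        simp at h3
        linarith
      rw [dslope_of_ne _ hsx, slope_def_field, norm_mul, norm_div, norm_div, norm_sub_rev s]
      have h4 : ‖(2 : ℂ) * d‖ = 2 * d := by
        rw [norm_mul, norm_real, Real.norm_of_nonneg hdpos.le]; simp
      have h5 : ‖G s - G x‖ ≤ C + ‖G x‖ :=
        (norm_sub_le _ _).trans (by gcongr; exact h1.trans (div_le_self hC0 hT0))
      rw [h4]
      calc _ ≤ (C + ‖G x‖) / (T / 2) * (2 * d / (T / 2)) := by gcongr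
        _ = _ := by field_simp; ring)
  have k3 : Tendsto (fun n : ℕ => G x * ((∫ v in (-(n : ℝ))..n, 2 * d / (d ^ 2 + v ^ 2) : ℝ) : ℂ))
      atTop (𝓝 (G x * ((2 * Real.pi : ℝ) : ℂ))) :=
    ((continuous_ofReal.tendsto _).comp (tendsto_integral_poisson hdpos)).const_mul _
  have hlim := (k1.add k2).add k3
  rw [zero_add, zero_add] at hlim
  have hline : ∀ {Q : ℂ → ℂ}, (∀ s : ℂ, c ≤ s.re → DifferentiableAt ℂ Q s) →
      Continuous fun v : ℝ => Q ((c : ℂ) + (v : ℂ) * I) := fun {Q} hQ =>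
    continuous_iff_continuousAt.2 fun v =>
      ContinuousAt.comp (g := Q) (f := fun v : ℝ => (c : ℂ) + (v : ℂ) * I)
        (hQ _ (by simp)).continuousAt (by fun_prop)
  have c1 := hline (Q := fun s => G s / (x' - s))
    (fun s hs => (hG s hs).div (by fun_prop) (hne' s hs))
  have c2 := hline (Q := fun s => dslope G x s * (2 * d / (x' - s)))
    (fun s hs => (hdsl s hs).mul ((differentiableAt_const _).div (by fun_prop) (hne' s hs)))
  have c3 : Continuous fun v : ℝ => G x * ((2 * d / (d ^ 2 + v ^ 2) : ℝ) : ℂ) := by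
    have : ∀ v : ℝ, d ^ 2 + v ^ 2 ≠ 0 := fun v => by positivity
    have h : Continuous fun v : ℝ => 2 * d / (d ^ 2 + v ^ 2) := by
      fun_prop (disch := exact this _)
    exact continuous_const.mul (continuous_ofReal.comp h)
  convert hlim using 2 with n
  · rw [← intervalIntegral.integral_ofReal, ← intervalIntegral.integral_const_mul,
      ← intervalIntegral.integral_add (c1.intervalIntegrable _ _) (c2.intervalIntegrable _ _),
      ← intervalIntegral.integral_add ((c1.fun_add c2).intervalIntegrable _ _)
        (c3.intervalIntegrable _ _)]
    refine intervalIntegral.integral_congr fun v _ => ?_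
    have hsx : (c : ℂ) + v * I ≠ x := fun h => by
      have := congrArg re h
      simp at this
      linarith
    have hdc : (d : ℂ) = x - c := by rw [hd]; push_cast; ring
    have n1 : (x : ℂ) - (c + v * I) ≠ 0 := sub_ne_zero.2 hsx.symm
    have n1' : (c : ℂ) + v * I - x ≠ 0 := sub_ne_zero.2 hsx
    have n2 : (x' : ℂ) - (c + v * I) ≠ 0 := hne' _ (by simp)
    have n3 : (d : ℂ) ^ 2 + v ^ 2 = -(((x : ℂ) - (c + v * I)) * (x' - (c + v * I))) := by
      rw [hdc, hx']; push_cast; ring_nf; rw [I_sq]; ring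
    rw [dslope_of_ne _ hsx, slope_def_field]
    push_cast
    rw [n3]
    have e1 : (2 * (d : ℂ)) = ((x : ℂ) - (c + v * I)) - (x' - (c + v * I)) := by
      rw [hdc, hx']; push_cast; ring
    have e2 : (c : ℂ) + v * I - x = -((x : ℂ) - (c + v * I)) := by ring
    rw [e1, e2]
    generalize (x : ℂ) - (c + v * I) = X at *
    generalize (x' : ℂ) - (c + v * I) = Y at *
    field_simp
    ring
  · push_cast; ring

end FoxH

/-! ### The Laplace transform of a loop integral. -/

namespace FoxH

open Complex Filter Topology MeasureTheory

/-- A function that is holomorphic off the half-line `(-∞, c)` and decays away from it. -/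
structure DecaysOffHalfLine (c d₀ C T₀ : ℝ) (G : ℂ → ℂ) : Prop where
  differentiableAt : ∀ s : ℂ, (s.im ≠ 0 ∨ c ≤ s.re) → DifferentiableAt ℂ G s
  norm_le_im : ∀ s : ℂ, d₀ ≤ |s.im| → ‖G s‖ ≤ C / |s.im|
  norm_le_re : ∀ s : ℂ, T₀ ≤ s.re → ‖G s‖ ≤ C / s.re

/-- The inverse Laplace transform of `G + ν` along a left loop. -/
noncomputable def loopTransform (c φ₁ φ₂ : ℝ) (G : ℂ → ℂ) (ν : ℂ) (l : ℝ) : ℂ :=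
  (2 * (Real.pi : ℂ) * I)⁻¹ * leftLoopIntegral c φ₁ φ₂ fun s => (G s + ν) * exp (l * s)

/-- The truncated inverse Laplace transform of `G` along a vertical line. -/
noncomputable def verticalTransform (c : ℝ) (G : ℂ → ℂ) (T l : ℝ) : ℂ :=
  (2 * (Real.pi : ℂ))⁻¹ *
    ∫ v in (-T)..T, G ((c : ℂ) + (v : ℂ) * I) * exp (l * ((c : ℂ) + (v : ℂ) * I))

lemma norm_exp_ofReal_mul (l : ℝ) (s : ℂ) : ‖exp (l * s)‖ = Real.exp (l * s.re) := by
  rw [norm_exp, re_ofReal_mul]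

section

variable {c d₀ C T₀ φ₁ φ₂ : ℝ} {G : ℂ → ℂ}

lemma DecaysOffHalfLine.continuous_vertical (hG : DecaysOffHalfLine c d₀ C T₀ G) :
    Continuous fun v : ℝ => G ((c : ℂ) + (v : ℂ) * I) :=
  continuous_iff_continuousAt.2 fun v =>
    ContinuousAt.comp (g := G) (f := fun v : ℝ => (c : ℂ) + (v : ℂ) * I)
      (hG.differentiableAt _ (by simp)).continuousAt (by fun_prop)

lemma DecaysOffHalfLine.const_nonneg (hG : DecaysOffHalfLine c d₀ C T₀ G) (hd : 0 < d₀) :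
    0 ≤ C := by
  have := (norm_nonneg _).trans (hG.norm_le_im (d₀ * I) (by simp [abs_of_pos hd]))
  simp only [mul_im, ofReal_re, I_im, mul_one, ofReal_im, I_re, mul_zero, add_zero,
    abs_of_pos hd] at this
  by_contra h
  exact absurd this (not_le.2 (div_neg_of_neg_of_pos (not_le.1 h) hd))

lemma DecaysOffHalfLine.exists_bound_vertical (hG : DecaysOffHalfLine c d₀ C T₀ G) (hd : 0 < d₀) :
    ∃ K : ℝ, 0 ≤ K ∧ ∀ v : ℝ, ‖G ((c : ℂ) + (v : ℂ) * I)‖ ≤ K := by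
  obtain ⟨K, hK⟩ := (isCompact_Icc (a := -d₀) (b := d₀)).exists_bound_of_continuousOn
    hG.continuous_vertical.continuousOn
  have hC := hG.const_nonneg hd
  refine ⟨max K (C / d₀), le_max_of_le_right (by positivity), fun v => ?_⟩
  by_cases hv : |v| ≤ d₀
  · exact (hK v (abs_le.1 hv)).trans (le_max_left _ _)
  · have h1 : d₀ ≤ |v| := (not_le.1 hv).le
    refine le_trans ?_ (le_max_right _ _)
    have := hG.norm_le_im ((c : ℂ) + (v : ℂ) * I) (by simpa using h1)
    simp only [add_im, ofReal_im, mul_im, ofReal_re, I_im, mul_one, I_re, mul_zero, add_zero,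
      zero_add] at this
    exact this.trans (by gcongr)

/-- The half-strips between the loop and the heights `±T` are free of singularities, so the loop may
be widened. The term `ν e^(ls)` is entire and drops out; it must, since only `G` tends to zero as
`T` grows. -/
lemma leftLoopIntegral_mul_exp_eq (hG : DecaysOffHalfLine c d₀ C T₀ G) (hd : 0 < d₀)
    (h₁ : φ₁ ≤ -d₀) (h₂ : d₀ ≤ φ₂) (ν : ℂ) {T l : ℝ} (hT₁ : -T ≤ φ₁) (hT₂ : φ₂ ≤ T) (hl : 0 < l) :
    leftLoopIntegral c φ₁ φ₂ (fun s => (G s + ν) * exp (l * s)) =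
      leftLoopIntegral c (-T) T (fun s => G s * exp (l * s)) := by
  have hC := hG.const_nonneg hd
  have hbd : ∀ s : ℂ, d₀ ≤ |s.im| → ‖G s‖ ≤ C / d₀ := fun s hs =>
    (hG.norm_le_im s hs).trans (by gcongr)
  have hexp : ∀ s : ℂ, DifferentiableAt ℂ (fun s : ℂ => exp (l * s)) s := fun s => by fun_prop
  have hdiff : ∀ s : ℂ, d₀ ≤ |s.im| → DifferentiableAt ℂ (fun s => (G s + ν) * exp (l * s)) s :=
    fun s hs => ((hG.differentiableAt s (Or.inl (abs_pos.1 (hd.trans_le hs)))).add_const ν).mul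
      (hexp s)
  have hM : ∀ s : ℂ, d₀ ≤ |s.im| →
      ‖(G s + ν) * exp (l * s)‖ ≤ (C / d₀ + ‖ν‖) * Real.exp (l * s.re) := fun s hs => by
    rw [norm_mul, norm_exp_ofReal_mul]
    gcongr
    exact (norm_add_le _ _).trans (by gcongr; exact hbd s hs)
  have z1 : leftLoopIntegral c (-T) φ₁ (fun s => (G s + ν) * exp (l * s)) = 0 :=
    leftLoopIntegral_eq_zero hl hT₁
      (fun s _ _ hs => hdiff s (le_abs.2 (Or.inr (by linarith))))
      (fun s _ _ hs => hM s (le_abs.2 (Or.inr (by linarith))))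
  have z2 : leftLoopIntegral c φ₂ T (fun s => (G s + ν) * exp (l * s)) = 0 :=
    leftLoopIntegral_eq_zero hl hT₂
      (fun s _ hs _ => hdiff s (le_abs.2 (Or.inl (by linarith))))
      (fun s _ hs _ => hM s (le_abs.2 (Or.inl (by linarith))))
  have hTd : d₀ ≤ |T| := le_abs.2 (Or.inl (by linarith))
  have z3 : leftLoopIntegral c (-T) T (fun s => ν * exp (l * s)) = 0 :=
    leftLoopIntegral_eq_zero (M := ‖ν‖) hl (by linarith)
      (fun s _ _ _ => (hexp s).const_mul ν)
      (fun s _ _ _ => by rw [norm_mul, norm_exp_ofReal_mul])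
  have hcont : Continuous fun v : ℝ =>
      (G ((c : ℂ) + (v : ℂ) * I) + ν) * exp (l * ((c : ℂ) + (v : ℂ) * I)) :=
    (hG.continuous_vertical.add continuous_const).mul (by fun_prop)
  have a1 := leftLoopIntegral_add_adjacent (y₁ := -T) (y₂ := φ₁) (y₃ := φ₂)
    (f := fun s => (G s + ν) * exp (l * s)) hcont
  have a2 := leftLoopIntegral_add_adjacent (y₁ := -T) (y₂ := φ₂) (y₃ := T)
    (f := fun s => (G s + ν) * exp (l * s)) hcont
  rw [z1, zero_add] at a1
  rw [z2, add_zero, ← a1] at a2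
  rw [a2]
  have hray : ∀ y : ℝ, d₀ ≤ |y| → IntegrableOn
      (fun u : ℝ => G ((u : ℂ) + (y : ℂ) * I) * exp (l * ((u : ℂ) + (y : ℂ) * I))) (Set.Iic c) :=
    fun y hy => integrableOn_horizontal (f := fun s => G s * exp (l * s)) (M := C / d₀) hl
      (fun u _ => ((hG.differentiableAt _ (Or.inl (by
        simpa using abs_pos.1 (hd.trans_le hy)))).mul (hexp _)).continuousAt)
      (fun u _ => by
        rw [norm_mul, norm_exp_ofReal_mul]
        have := hbd ((u : ℂ) + (y : ℂ) * I) (by simpa using hy)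
        simp only [add_re, ofReal_re, mul_re, I_re, mul_zero, ofReal_im, I_im, mul_one, sub_self,
          add_zero]
        gcongr)
  have hray' : ∀ y : ℝ, IntegrableOn
      (fun u : ℝ => ν * exp (l * ((u : ℂ) + (y : ℂ) * I))) (Set.Iic c) :=
    fun y => integrableOn_horizontal (f := fun s => ν * exp (l * s)) (M := ‖ν‖) hl
      (fun u _ => ((hexp _).const_mul ν).continuousAt)
      (fun u _ => by rw [norm_mul, norm_exp_ofReal_mul]; simp)
  have v1 : Continuous fun v : ℝ =>
      G ((c : ℂ) + (v : ℂ) * I) * exp (l * ((c : ℂ) + (v : ℂ) * I)) * I :=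
    (hG.continuous_vertical.mul (by fun_prop)).mul continuous_const
  have v2 : Continuous fun v : ℝ => ν * exp (l * ((c : ℂ) + (v : ℂ) * I)) * I := by fun_prop
  rw [← add_zero (leftLoopIntegral c (-T) T fun s => G s * exp (l * s)), ← z3]
  simp only [leftLoopIntegral, add_mul]
  rw [integral_add (hray _ (by rwa [abs_neg])) (hray' _), integral_add (hray _ hTd) (hray' _),
    intervalIntegral.integral_add (v1.intervalIntegrable _ _) (v2.intervalIntegrable _ _)]
  ring

/-- For the loop widened to height `T`, the difference consists of the two rays, on which `|G| ≤ C /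
T`. -/
lemma norm_loopTransform_sub_verticalTransform_le (hG : DecaysOffHalfLine c d₀ C T₀ G)
    (hd : 0 < d₀) (h₁ : φ₁ ≤ -d₀) (h₂ : d₀ ≤ φ₂) (ν : ℂ) {T l : ℝ} (hT₁ : -T ≤ φ₁) (hT₂ : φ₂ ≤ T)
    (hl : 0 < l) :
    ‖loopTransform c φ₁ φ₂ G ν l - verticalTransform c G T l‖ ≤ C / T * (Real.exp (l * c) / l) := by
  have hC := hG.const_nonneg hd
  have hTd : d₀ ≤ T := h₂.trans hT₂
  have hT : 0 < T := hd.trans_le hTd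
  have hray : ∀ y : ℝ, |y| = T →
      ‖∫ u in Set.Iic c, G ((u : ℂ) + (y : ℂ) * I) * exp (l * ((u : ℂ) + (y : ℂ) * I))‖ ≤
        C / T * (Real.exp (l * c) / l) := fun y hy =>
    norm_integral_horizontal_le (f := fun s => G s * exp (l * s)) hl fun u _ => by
      rw [norm_mul, norm_exp_ofReal_mul]
      have := hG.norm_le_im ((u : ℂ) + (y : ℂ) * I) (by simpa [hy] using hTd)
      simp only [add_im, ofReal_im, mul_im, ofReal_re, I_im, mul_one, I_re, mul_zero, add_zero,
        zero_add, hy] at this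
      simp only [add_re, ofReal_re, mul_re, I_re, mul_zero, ofReal_im, I_im, mul_one, sub_self,
        add_zero]
      gcongr
  have hpi : (Real.pi : ℂ) ≠ 0 := ofReal_ne_zero.2 Real.pi_ne_zero
  have heq : loopTransform c φ₁ φ₂ G ν l - verticalTransform c G T l = (2 * (Real.pi : ℂ) * I)⁻¹ *
      ((∫ u in Set.Iic c, G ((u : ℂ) + ((-T : ℝ) : ℂ) * I) *
        exp (l * ((u : ℂ) + ((-T : ℝ) : ℂ) * I))) -
      ∫ u in Set.Iic c, G ((u : ℂ) + (T : ℂ) * I) * exp (l * ((u : ℂ) + (T : ℂ) * I))) := by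
    rw [loopTransform, verticalTransform, leftLoopIntegral_mul_exp_eq hG hd h₁ h₂ ν hT₁ hT₂ hl,
      leftLoopIntegral, intervalIntegral.integral_mul_const]
    generalize (∫ v in (-T)..T, G ((c : ℂ) + (v : ℂ) * I) * exp (l * ((c : ℂ) + (v : ℂ) * I))) = X
    generalize (∫ u in Set.Iic c, G ((u : ℂ) + ((-T : ℝ) : ℂ) * I) *
        exp (l * ((u : ℂ) + ((-T : ℝ) : ℂ) * I))) = Y
    generalize (∫ u in Set.Iic c, G ((u : ℂ) + (T : ℂ) * I) *
        exp (l * ((u : ℂ) + (T : ℂ) * I))) = Z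
    field_simp
    ring
  have hn : ‖(2 * (Real.pi : ℂ) * I)⁻¹‖ = (2 * Real.pi)⁻¹ := by
    rw [norm_inv, norm_mul, norm_mul, norm_I, norm_real, Real.norm_of_nonneg Real.pi_pos.le]
    simp
  rw [heq, norm_mul, hn]
  have h2 := (norm_sub_le _ _).trans (add_le_add (hray (-T) (by rw [abs_neg, abs_of_pos hT]))
    (hray T (abs_of_pos hT)))
  have hnn : 0 ≤ C / T * (Real.exp (l * c) / l) := by positivity
  calc _ ≤ (2 * Real.pi)⁻¹ * (C / T * (Real.exp (l * c) / l) + C / T * (Real.exp (l * c) / l)) := by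
        gcongr
    _ = Real.pi⁻¹ * (C / T * (Real.exp (l * c) / l)) := by field_simp; ring
    _ ≤ _ := mul_le_of_le_one_left hnn (inv_le_one_of_one_le₀ (by linarith [Real.pi_gt_three]))

lemma norm_verticalTransform_le {K : ℝ} (hK : ∀ v : ℝ, ‖G ((c : ℂ) + (v : ℂ) * I)‖ ≤ K)
    {T : ℝ} (hT : 0 ≤ T) (l : ℝ) :
    ‖verticalTransform c G T l‖ ≤ K * T * Real.exp (l * c) := by
  have hK0 : 0 ≤ K := (norm_nonneg _).trans (hK 0)
  have h1 : ‖∫ v in (-T)..T, G ((c : ℂ) + (v : ℂ) * I) * exp (l * ((c : ℂ) + (v : ℂ) * I))‖ ≤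
      K * Real.exp (l * c) * |T - -T| :=
    intervalIntegral.norm_integral_le_of_norm_le_const fun v _ => by
      rw [norm_mul, norm_exp_ofReal_mul]
      simp only [add_re, ofReal_re, mul_re, I_re, mul_zero, ofReal_im, I_im, mul_one, sub_self,
        add_zero]
      gcongr
      exact hK v
  have hn : ‖(2 * (Real.pi : ℂ))⁻¹‖ = (2 * Real.pi)⁻¹ := by
    rw [norm_inv, norm_mul, norm_real, Real.norm_of_nonneg Real.pi_pos.le]
    simp
  rw [verticalTransform, norm_mul, hn]
  have h2 : |T - -T| = 2 * T := by rw [sub_neg_eq_add, abs_of_nonneg (by linarith)]; ring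
  rw [h2] at h1
  calc _ ≤ (2 * Real.pi)⁻¹ * (K * Real.exp (l * c) * (2 * T)) := by gcongr
    _ = Real.pi⁻¹ * (K * T * Real.exp (l * c)) := by field_simp
    _ ≤ _ := mul_le_of_le_one_left (by positivity)
      (inv_le_one_of_one_le₀ (by linarith [Real.pi_gt_three]))

lemma continuous_verticalTransform (hG : DecaysOffHalfLine c d₀ C T₀ G) (T : ℝ) :
    Continuous (verticalTransform c G T) := by
  refine continuous_const.mul
    (intervalIntegral.continuous_parametric_intervalIntegral_of_continuous' ?_ _ _)
  exact (hG.continuous_vertical.comp continuous_snd).mul (by fun_prop)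

lemma continuousOn_loopTransform (hG : DecaysOffHalfLine c d₀ C T₀ G)
    (hd : 0 < d₀) (h₁ : φ₁ ≤ -d₀) (h₂ : d₀ ≤ φ₂) (ν : ℂ) :
    ContinuousOn (loopTransform c φ₁ φ₂ G ν) (Set.Ioi 0) := by
  have hC := hG.const_nonneg hd
  refine TendstoLocallyUniformlyOn.continuousOn (p := atTop)
    (F := fun n : ℕ => verticalTransform c G n) ?_
    (Eventually.of_forall fun n : ℕ =>
      (continuous_verticalTransform hG (n : ℝ)).continuousOn).frequently
  rw [tendstoLocallyUniformlyOn_iff_forall_isCompact isOpen_Ioi]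
  intro S hS hSc
  obtain ⟨D, hD⟩ := hSc.exists_bound_of_continuousOn (f := fun l : ℝ => Real.exp (l * c) / l)
    ((by fun_prop : Continuous fun l : ℝ => Real.exp (l * c)).continuousOn.div continuousOn_id
      fun l hl => (hS hl).ne')
  rw [Metric.tendstoUniformlyOn_iff]
  intro ε hε
  have hz : Tendsto (fun n : ℕ => C * D * ((n : ℝ)⁻¹)) atTop (𝓝 0) := by
    simpa using (tendsto_inv_atTop_nhds_zero_nat (𝕜 := ℝ)).const_mul (C * D)
  have htop := tendsto_natCast_atTop_atTop (R := ℝ)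
  filter_upwards [hz.eventually_lt_const hε, htop.eventually_ge_atTop (-φ₁),
    htop.eventually_ge_atTop φ₂] with n hn hn1 hn2 l hl
  rw [dist_eq_norm]
  refine lt_of_le_of_lt ?_ hn
  refine (norm_loopTransform_sub_verticalTransform_le hG hd h₁ h₂ ν (by linarith) hn2
    (hS hl)).trans ?_
  rw [div_eq_mul_inv, mul_right_comm]
  gcongr
  exact (le_abs_self _).trans (hD l hl)

lemma tendsto_verticalTransform (hG : DecaysOffHalfLine c d₀ C T₀ G)
    (hd : 0 < d₀) (h₁ : φ₁ ≤ -d₀) (h₂ : d₀ ≤ φ₂) (ν : ℂ) {l : ℝ} (hl : 0 < l) :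
    Tendsto (fun n : ℕ => verticalTransform c G n l) atTop (𝓝 (loopTransform c φ₁ φ₂ G ν l)) := by
  rw [tendsto_iff_norm_sub_tendsto_zero]
  have hz : Tendsto (fun n : ℕ => C * (Real.exp (l * c) / l) * ((n : ℝ)⁻¹)) atTop (𝓝 0) := by
    simpa using (tendsto_inv_atTop_nhds_zero_nat (𝕜 := ℝ)).const_mul (C * (Real.exp (l * c) / l))
  have htop := tendsto_natCast_atTop_atTop (R := ℝ)
  refine squeeze_zero_norm' ?_ hz
  filter_upwards [htop.eventually_ge_atTop (-φ₁), htop.eventually_ge_atTop φ₂] with n hn1 hn2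
  rw [norm_norm, norm_sub_rev]
  refine (norm_loopTransform_sub_verticalTransform_le hG hd h₁ h₂ ν (by linarith) hn2
    hl).trans_eq ?_
  ring

/-- A majorant independent of `T` and integrable at `l = 0`, for dominated convergence. The trivial
bound grows like `T` and the distance to the limit is of order `1/(T l)`; they balance at `T =
l^(-1/2)`. -/
lemma exists_norm_verticalTransform_le (hG : DecaysOffHalfLine c d₀ C T₀ G)
    (hd : 0 < d₀) (h₁ : φ₁ ≤ -d₀) (h₂ : d₀ ≤ φ₂) :
    ∃ D : ℝ, 0 ≤ D ∧ ∀ (T l : ℝ), 0 ≤ T → 0 < l →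
      ‖verticalTransform c G T l‖ ≤ D * (1 + l ^ (-(1 / 2) : ℝ)) * Real.exp (l * c) := by
  obtain ⟨K, hK0, hK⟩ := hG.exists_bound_vertical hd
  have hC := hG.const_nonneg hd
  -- `N` exceeds both heights of the loop, so every `T ≥ N` is admissible for the comparison with
  -- the loop.
  set N : ℝ := φ₂ - φ₁ with hN
  have hNpos : 0 < N := by linarith
  refine ⟨K * N + K + 2 * C, by positivity, fun T l hT hl => ?_⟩
  set r : ℝ := l ^ (-(1 / 2) : ℝ) with hr
  have hrpos : 0 < r := Real.rpow_pos_of_pos hl _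
  have hrl : r * r * l = 1 := by
    rw [hr, ← Real.rpow_add hl, ← Real.rpow_add_one hl.ne']; norm_num
  set e : ℝ := Real.exp (l * c) with he
  have hepos : 0 < e := Real.exp_pos _
  have hsmall : ∀ T' : ℝ, 0 ≤ T' → T' ≤ N + r →
      ‖verticalTransform c G T' l‖ ≤ K * (N + r) * e := fun T' h0 h =>
    (norm_verticalTransform_le hK h0 l).trans (by gcongr)
  by_cases hTN : T ≤ N + r
  · refine (hsmall T hT hTN).trans (mul_le_mul_of_nonneg_right ?_ hepos.le)
    nlinarith [mul_nonneg hK0 hNpos.le, mul_nonneg hK0 hrpos.le, mul_nonneg hC hrpos.le,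
      mul_nonneg (mul_nonneg hK0 hNpos.le) hrpos.le]
  · have hTN' : N + r ≤ T := (not_le.1 hTN).le
    have hb : ∀ T' : ℝ, N + r ≤ T' →
        ‖loopTransform c φ₁ φ₂ G 0 l - verticalTransform c G T' l‖ ≤ C * r * e := fun T' h => by
      refine (norm_loopTransform_sub_verticalTransform_le hG hd h₁ h₂ 0 (by linarith)
        (by linarith) hl).trans ?_
      have h3 : C / T' ≤ C / r := by gcongr; linarith
      have h4 : e / l = e * (r * r) := by rw [div_eq_iff hl.ne', mul_assoc, hrl, mul_one]
      rw [h4]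
      calc _ ≤ C / r * (e * (r * r)) := by gcongr
        _ = _ := by field_simp
    have h0 := hsmall (N + r) (by positivity) le_rfl
    have h3 : verticalTransform c G T l = verticalTransform c G (N + r) l +
        (loopTransform c φ₁ φ₂ G 0 l - verticalTransform c G (N + r) l) -
        (loopTransform c φ₁ φ₂ G 0 l - verticalTransform c G T l) := by ring
    rw [h3]
    refine (norm_sub_le _ _).trans ((add_le_add (norm_add_le _ _) le_rfl).trans ?_)
    refine (add_le_add (add_le_add h0 (hb _ le_rfl)) (hb T hTN')).trans ?_
    have : K * (N + r) * e + C * r * e + C * r * e = (K * N + K * r + 2 * C * r) * e := by ring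
    rw [this]
    refine mul_le_mul_of_nonneg_right ?_ hepos.le
    nlinarith [mul_nonneg hK0 hNpos.le, mul_nonneg hK0 hrpos.le, mul_nonneg hC hrpos.le,
      mul_nonneg (mul_nonneg hK0 hNpos.le) hrpos.le]

/-- Fubini on a finite vertical segment, where `Re s = c < x` gives absolute convergence. -/
lemma integral_verticalTransform_mul_exp (hG : DecaysOffHalfLine c d₀ C T₀ G) (hd : 0 < d₀)
    {T x : ℝ} (hT : 0 ≤ T) (hx : c < x) :
    ∫ l in Set.Ioi (0 : ℝ), verticalTransform c G T l * exp (-(x * l)) =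
      (2 * (Real.pi : ℂ))⁻¹ * ∫ v in (-T)..T,
        G ((c : ℂ) + (v : ℂ) * I) / (x - ((c : ℂ) + (v : ℂ) * I)) := by
  obtain ⟨K, hK0, hK⟩ := hG.exists_bound_vertical hd
  have hTT : -T ≤ T := by linarith
  set f : ℝ → ℝ → ℂ := fun l v =>
    G ((c : ℂ) + (v : ℂ) * I) * exp (((c : ℂ) + (v : ℂ) * I - x) * l) with hf
  have h1 : ∀ l : ℝ, verticalTransform c G T l * exp (-(x * l)) =
      (2 * (Real.pi : ℂ))⁻¹ * ∫ v in Set.Ioc (-T) T, f l v := fun l => by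
    rw [verticalTransform, mul_assoc, ← intervalIntegral.integral_mul_const,
      intervalIntegral.integral_of_le hTT]
    congr 1
    refine integral_congr_ae (Eventually.of_forall fun v => ?_)
    simp only [hf, mul_assoc, ← exp_add]
    ring_nf
  simp_rw [h1]
  rw [integral_const_mul, integral_integral_swap, intervalIntegral.integral_of_le hTT]
  · congr 1
    refine integral_congr_ae (Eventually.of_forall fun v => ?_)
    simp only [hf]
    have hre : ((c : ℂ) + (v : ℂ) * I - x).re < 0 := by simp; linarith
    have hne : (c : ℂ) + (v : ℂ) * I - x ≠ 0 := fun h => by rw [h] at hre; simp at hre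
    have hne' : (x : ℂ) - (c + (v : ℂ) * I) ≠ 0 := fun h => hne (by linear_combination -h)
    rw [integral_const_mul, integral_exp_mul_complex_Ioi hre]
    simp only [ofReal_zero, mul_zero, exp_zero]
    field_simp
    ring
  · have hint : Integrable (fun z : ℝ × ℝ => Real.exp ((c - x) * z.1) * K)
        ((volume.restrict (Set.Ioi 0)).prod (volume.restrict (Set.Ioc (-T) T))) :=
      Integrable.mul_prod (f := fun l : ℝ => Real.exp ((c - x) * l)) (g := fun _ : ℝ => K)
        (integrableOn_exp_mul_Ioi (by linarith) 0) (integrable_const K)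
    refine hint.mono' ?_ (Eventually.of_forall fun z => ?_)
    · refine Continuous.aestronglyMeasurable ?_
      exact (hG.continuous_vertical.comp continuous_snd).mul (by fun_prop)
    · simp only [Function.uncurry, hf, norm_mul, norm_exp]
      rw [mul_comm]
      gcongr
      · apply le_of_eq; simp
      · exact hK _

/-- The Laplace transform of the loop integral of `(G(s) + ν) exp(l s)` is `G`. -/
theorem laplace_loopTransform (hG : DecaysOffHalfLine c d₀ C T₀ G) (hd : 0 < d₀) (h₁ : φ₁ ≤ -d₀)
    (h₂ : d₀ ≤ φ₂) (ν : ℂ) {x : ℝ} (hx : c < x) :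
    IntegrableOn (fun l : ℝ => loopTransform c φ₁ φ₂ G ν l * exp (-(x * l))) (Set.Ioi 0) ∧
      ∫ l in Set.Ioi (0 : ℝ), loopTransform c φ₁ φ₂ G ν l * exp (-(x * l)) = G x := by
  obtain ⟨D, hD0, hD⟩ := exists_norm_verticalTransform_le hG hd h₁ h₂
  set bound : ℝ → ℝ := fun l =>
    D * (Real.exp ((c - x) * l) + l ^ (-(1 / 2) : ℝ) * Real.exp (-(x - c) * l ^ (1 : ℝ))) with hb
  have hbint : IntegrableOn bound (Set.Ioi 0) :=
    ((integrableOn_exp_mul_Ioi (by linarith) 0).add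
      (integrableOn_rpow_mul_exp_neg_mul_rpow (by norm_num) one_pos (sub_pos.2 hx))).const_mul D
  have hle : ∀ z : ℂ, ∀ l ∈ Set.Ioi (0 : ℝ),
      ‖z‖ ≤ D * (1 + l ^ (-(1 / 2) : ℝ)) * Real.exp (l * c) → ‖z * exp (-(x * l))‖ ≤ bound l := by
    intro z l hl hz
    have he : ‖exp (-((x : ℂ) * l))‖ = Real.exp (-(x * l)) := by rw [norm_exp]; simp
    rw [norm_mul, he]
    refine (mul_le_mul_of_nonneg_right hz (Real.exp_pos _).le).trans_eq ?_
    rw [mul_assoc, ← Real.exp_add, hb]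
    simp only [Real.rpow_one]
    ring_nf
  have hmeas : ∀ n : ℕ, AEStronglyMeasurable
      (fun l : ℝ => verticalTransform c G n l * exp (-(x * l))) (volume.restrict (Set.Ioi 0)) :=
    fun n => ((continuous_verticalTransform hG n).mul (by fun_prop)).aestronglyMeasurable
  have hlim : ∀ l ∈ Set.Ioi (0 : ℝ), Tendsto
      (fun n : ℕ => verticalTransform c G n l * exp (-(x * l))) atTop
      (𝓝 (loopTransform c φ₁ φ₂ G ν l * exp (-(x * l)))) := fun l hl =>
    (tendsto_verticalTransform hG hd h₁ h₂ ν hl).mul_const _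
  constructor
  · refine Integrable.mono' hbint ?_ ?_
    · refine ContinuousOn.aestronglyMeasurable ?_ measurableSet_Ioi
      exact (continuousOn_loopTransform hG hd h₁ h₂ ν).mul (by fun_prop)
    · rw [ae_restrict_iff' measurableSet_Ioi]
      refine Eventually.of_forall fun l hl => ?_
      exact hle _ l hl (le_of_tendsto (tendsto_verticalTransform hG hd h₁ h₂ ν hl).norm
        (Eventually.of_forall fun n => hD n l (Nat.cast_nonneg n) hl))
  · have t1 := tendsto_integral_of_dominated_convergence bound hmeas hbint
      (fun n => by
        rw [ae_restrict_iff' measurableSet_Ioi]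
        exact Eventually.of_forall fun l hl => hle _ l hl (hD n l (Nat.cast_nonneg n) hl))
      (by
        rw [ae_restrict_iff' measurableSet_Ioi]
        exact Eventually.of_forall hlim)
    have t2 := (tendsto_integral_cauchy_halfPlane (G := G) (c := c) (C := C) (T₀ := max T₀ d₀)
      (fun s hs => hG.differentiableAt s (Or.inr hs)) (fun T hT s hs hsT => by
        rcases hsT with h | h
        · rw [← h]
          exact hG.norm_le_im s (by rw [h]; exact (le_max_right _ _).trans hT)
        · rw [← h]
          exact hG.norm_le_re s (by rw [h]; exact (le_max_left _ _).trans hT)) hx).const_mul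
      (2 * (Real.pi : ℂ))⁻¹
    have hpi : (2 * (Real.pi : ℂ)) ≠ 0 :=
      mul_ne_zero two_ne_zero (ofReal_ne_zero.2 Real.pi_ne_zero)
    rw [inv_mul_cancel_left₀ hpi] at t2
    refine tendsto_nhds_unique t1 (t2.congr fun n => ?_)
    rw [integral_verticalTransform_mul_exp hG hd (Nat.cast_nonneg n) hx]

end

end FoxH

/-! ### The Laplace representation of the gamma ratio to the right of its poles. -/

namespace FoxH

open Complex Filter Topology MeasureTheory

section

variable {p q : ℕ} {A a : Fin p → ℝ} {B b : Fin q → ℝ}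

lemma prod_inv_Gamma_differentiable (A a : Fin p → ℝ) :
    Differentiable ℂ fun s : ℂ => ∏ k, (Gamma ((A k : ℂ) * s + a k))⁻¹ := fun s => by
  refine DifferentiableAt.fun_finsetProd fun k _ => ?_
  exact (differentiable_one_div_Gamma _).comp s
    (((differentiableAt_const (A k : ℂ)).mul differentiableAt_id).add_const _)

lemma affine_ne_neg_nat (hA : ∀ k, 0 < A k) {c : ℝ} (hc : ∀ k, -a k / A k < c) {s : ℂ}
    (hs : s.im ≠ 0 ∨ c ≤ s.re) (k : Fin p) (m : ℕ) : (A k : ℂ) * s + a k ≠ -m := by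
  intro h
  have him := congrArg im h
  have hre := congrArg re h
  simp only [add_im, im_ofReal_mul, ofReal_im, add_zero, neg_im, natCast_im, neg_zero,
    mul_eq_zero, (hA k).ne', false_or, add_re, re_ofReal_mul, ofReal_re, neg_re,
    natCast_re] at him hre
  rcases hs with hs | hs
  · exact hs him
  · have h1 := (div_lt_iff₀ (hA k)).1 (hc k)
    have h2 := mul_le_mul_of_nonneg_left hs (hA k).le
    have h3 : (0 : ℝ) ≤ m := Nat.cast_nonneg m
    nlinarith

/-- The denominator enters through the entire function `1/Γ`, so only the poles of the numerator
matter, and these are real and less than `c`. -/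
lemma differentiableAt_normRatio (hA : ∀ k, 0 < A k) {c : ℝ} (hc : ∀ k, -a k / A k < c) {s : ℂ}
    (hs : s.im ≠ 0 ∨ c ≤ s.re) : DifferentiableAt ℂ (normRatio A a B b) s := by
  have h1 : DifferentiableAt ℂ (fun s : ℂ => ∏ k, Gamma ((A k : ℂ) * s + a k)) s :=
    DifferentiableAt.fun_finsetProd fun k _ =>
      (differentiableAt_Gamma _ (affine_ne_neg_nat hA hc hs k)).comp s
        (((differentiableAt_const (A k : ℂ)).mul differentiableAt_id).add_const _)
  have h2 := (h1.mul (prod_inv_Gamma_differentiable B b s)).mul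
    (by fun_prop : DifferentiableAt ℂ (fun s : ℂ => exp (-(s * Real.log (rho A B)))) s)
  refine h2.congr_of_eventuallyEq (Eventually.of_forall fun s => ?_)
  simp only [normRatio, gammaRatioC, Finset.prod_inv_distrib, div_eq_mul_inv, Pi.mul_apply]

lemma decaysOffHalfLine_normRatio (hA : ∀ k, 0 < A k) (hB : ∀ j, 0 < B j)
    (hΔ : (∑ j, B j) - (∑ k, A k) = 0) (hμ : mu a b = 0) {c : ℝ} (hc : ∀ k, -a k / A k < c)
    {d₀ : ℝ} (hd₀ : 0 < d₀) :
    ∃ C T₀ : ℝ, DecaysOffHalfLine c d₀ C T₀ fun s => normRatio A a B b s - nu A a B b := by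
  obtain ⟨C, R, _, _, h⟩ := norm_normRatio_sub_nu_le hA hB hΔ hμ hd₀
  refine ⟨C, max R d₀, fun s hs => (differentiableAt_normRatio hA hc hs).sub_const _,
    fun s hs => h s _ hs (Or.inl le_rfl), fun s hs =>
      h s _ ((le_max_right _ _).trans hs) (Or.inr ⟨(le_max_left _ _).trans hs, le_rfl⟩)⟩

lemma gammaRatioC_ofReal (A a : Fin p → ℝ) (B b : Fin q → ℝ) (x : ℝ) :
    gammaRatioC A a B b x = gammaRatio A a B b x := by
  simp only [gammaRatioC, gammaRatio, ofReal_div, ofReal_prod, ← Gamma_ofReal, ofReal_add,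
    ofReal_mul]

/-- Here `x^(-s) = e^(ts)`, and moving `ρ^s` out of the gamma ratio shifts `t` to `t + log ρ`. -/
lemma foxH_exp_neg (c φ₁ φ₂ : ℝ) (A a : Fin p → ℝ) (B b : Fin q → ℝ) (t : ℝ) :
    foxH c φ₁ φ₂ A a B b (Real.exp (-t)) =
      loopTransform c φ₁ φ₂ (fun s => normRatio A a B b s - nu A a B b) (nu A a B b)
        (t + Real.log (rho A B)) := by
  rw [foxH, loopTransform]
  congr 2
  ext s
  rw [sub_add_cancel, normRatio, mul_assoc, ← exp_add]
  congr 1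
  rw [cpow_def_of_ne_zero (ofReal_ne_zero.2 (Real.exp_pos _).ne'), ← ofReal_log (Real.exp_pos _).le,
    Real.log_exp]
  congr 1
  push_cast
  ring

lemma continuousOn_foxH_exp_neg
    (hA : ∀ k, 0 < A k) (hB : ∀ j, 0 < B j) (hΔ : (∑ j, B j) - (∑ k, A k) = 0)
    (hμ : mu a b = 0) {c φ₁ φ₂ : ℝ} (hφ₁ : φ₁ < 0) (hφ₂ : 0 < φ₂) (hc : ∀ k, -a k / A k < c) :
    ContinuousOn (fun t : ℝ => foxH c φ₁ φ₂ A a B b (Real.exp (-t)))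
      (Set.Ioi (-Real.log (rho A B))) := by
  have hd₀ : 0 < min (-φ₁) φ₂ := lt_min (neg_pos.2 hφ₁) hφ₂
  obtain ⟨C, T₀, hG⟩ := decaysOffHalfLine_normRatio hA hB hΔ hμ hc hd₀
  simp_rw [foxH_exp_neg]
  refine (continuousOn_loopTransform hG hd₀ (by linarith [min_le_left (-φ₁) φ₂])
    (min_le_right _ _) _).comp (by fun_prop) fun t ht => ?_
  have : -Real.log (rho A B) < t := ht
  simp only [Set.mem_Ioi]
  linarith

/-- The Laplace representation of the gamma ratio to the right of the abscissa `c`. -/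
lemma laplace_foxH
    (hA : ∀ k, 0 < A k) (hB : ∀ j, 0 < B j) (hΔ : (∑ j, B j) - (∑ k, A k) = 0)
    (hμ : mu a b = 0) {c φ₁ φ₂ : ℝ} (hφ₁ : φ₁ < 0) (hφ₂ : 0 < φ₂) (hc : ∀ k, -a k / A k < c)
    {x : ℝ} (hx : c < x) :
    IntegrableOn (fun t : ℝ => foxH c φ₁ φ₂ A a B b (Real.exp (-t)) * exp (-(x * t)))
        (Set.Ioi (-Real.log (rho A B))) ∧
      (gammaRatio A a B b x : ℂ) = nu A a B b * exp (-(x * (-Real.log (rho A B) : ℝ))) +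
        ∫ t in Set.Ioi (-Real.log (rho A B)),
          foxH c φ₁ φ₂ A a B b (Real.exp (-t)) * exp (-(x * t)) := by
  have hd₀ : 0 < min (-φ₁) φ₂ := lt_min (neg_pos.2 hφ₁) hφ₂
  obtain ⟨C, T₀, hG⟩ := decaysOffHalfLine_normRatio hA hB hΔ hμ hc hd₀
  obtain ⟨h1, h2⟩ := laplace_loopTransform hG hd₀ (le_neg_of_le_neg (min_le_left (-φ₁) φ₂))
    (min_le_right _ _) (nu A a B b) hx
  set r := Real.log (rho A B) with hr
  set f : ℝ → ℂ := fun l => loopTransform c φ₁ φ₂ (fun s => normRatio A a B b s - nu A a B b)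
    (nu A a B b) l * exp (-(x * l)) with hf
  have hshift : ∀ t : ℝ, foxH c φ₁ φ₂ A a B b (Real.exp (-t)) * exp (-(x * t)) =
      f (t + r) * exp (x * r) := fun t => by
    rw [foxH_exp_neg, hf]
    simp only
    rw [mul_assoc, ← exp_add]
    congr 2
    push_cast
    ring
  have hmp := measurePreserving_add_right (volume : Measure ℝ) r
  have hme := (MeasurableEquiv.addRight r).measurableEmbedding
  have hpre : (fun t : ℝ => t + r) ⁻¹' Set.Ioi 0 = Set.Ioi (-r) := by
    ext t; simp [neg_lt_iff_pos_add]
  have hI : IntegrableOn (fun t : ℝ => f (t + r)) (Set.Ioi (-r)) := by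
    rw [← hpre]
    exact (hmp.integrableOn_comp_preimage hme).2 h1
  simp_rw [hshift]
  refine ⟨hI.mul_const _, ?_⟩
  have hval : ∫ t in Set.Ioi (-r), f (t + r) = normRatio A a B b x - nu A a B b := by
    rw [← h2, ← hpre]
    exact hmp.setIntegral_preimage_emb hme f _
  rw [integral_mul_const, hval, normRatio, gammaRatioC_ofReal, ← hr, sub_mul, mul_assoc,
    ← exp_add]
  push_cast
  simp

end

end FoxH

/-! ### Derivatives of Laplace transforms and positivity by Post–Widder inversion. -/

namespace FoxH

open Complex Filter Topology MeasureTheory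

section LaplaceDerivatives

variable {μ : Measure ℝ} {g : ℝ → ℂ} {c : ℝ}

/-- Part of the exponential, `e^(-(x - y)t)` with `c < y < x`, is spent on absorbing `t^n`. -/
lemma integrable_pow_mul_laplace (hsupp : ∀ᵐ t ∂μ, 0 ≤ t)
    (hint : ∀ x : ℝ, c < x → Integrable (fun t : ℝ => g t * exp (-(x * t))) μ) (n : ℕ) {x : ℝ}
    (hx : c < x) : Integrable (fun t : ℝ => (t : ℂ) ^ n * (g t * exp (-(x * t)))) μ := by
  obtain ⟨y, hcy, hyx⟩ := exists_between hx
  have hδ : 0 < x - y := sub_pos.2 hyx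
  refine Integrable.mono' ((hint y hcy).norm.const_mul (n.factorial / (x - y) ^ n))
    ((by fun_prop : Continuous fun t : ℝ => (t : ℂ) ^ n).aestronglyMeasurable.mul (hint x hx).1) ?_
  filter_upwards [hsupp] with t ht
  have h1 := Real.pow_div_factorial_le_exp ((x - y) * t) (by positivity) n
  rw [norm_mul, norm_mul, norm_mul, norm_pow, norm_exp, norm_exp, norm_real,
    Real.norm_of_nonneg ht]
  simp only [neg_re, re_ofReal_mul, ofReal_re]
  have h2 : t ^ n ≤ n.factorial / (x - y) ^ n * Real.exp ((x - y) * t) := by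
    rw [div_le_iff₀ (by positivity), mul_pow] at h1
    rw [div_mul_eq_mul_div, le_div_iff₀ (by positivity)]
    linarith
  calc _ ≤ (n.factorial / (x - y) ^ n * Real.exp ((x - y) * t)) *
        (‖g t‖ * Real.exp (-(x * t))) := by gcongr
    _ = n.factorial / (x - y) ^ n * (‖g t‖ * (Real.exp ((x - y) * t) * Real.exp (-(x * t)))) := by
        ring
    _ = _ := by rw [← Real.exp_add]; ring_nf

lemma hasDerivAt_laplace_pow (hsupp : ∀ᵐ t ∂μ, 0 ≤ t)
    (hint : ∀ x : ℝ, c < x → Integrable (fun t : ℝ => g t * exp (-(x * t))) μ) (n : ℕ) {x : ℝ}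
    (hx : c < x) :
    HasDerivAt (fun x : ℝ => ∫ t : ℝ, (t : ℂ) ^ n * (g t * exp (-(x * t))) ∂μ)
      (-∫ t : ℝ, (t : ℂ) ^ (n + 1) * (g t * exp (-(x * t))) ∂μ) x := by
  obtain ⟨y, hcy, hyx⟩ := exists_between hx
  rw [← integral_neg]
  refine (hasDerivAt_integral_of_dominated_loc_of_deriv_le
    (F := fun (x : ℝ) (t : ℝ) => (t : ℂ) ^ n * (g t * exp (-(x * t))))
    (F' := fun (x : ℝ) (t : ℝ) => -((t : ℂ) ^ (n + 1) * (g t * exp (-(x * t)))))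
    (bound := fun t : ℝ => ‖(t : ℂ) ^ (n + 1) * (g t * exp (-(y * t)))‖)
    (Ioi_mem_nhds hyx) ?_ (integrable_pow_mul_laplace hsupp hint n hx)
    (integrable_pow_mul_laplace hsupp hint (n + 1) hx).1.neg ?_
    (integrable_pow_mul_laplace hsupp hint (n + 1) hcy).norm ?_).2
  · filter_upwards [Ioi_mem_nhds hx] with z hz
    exact (integrable_pow_mul_laplace hsupp hint n hz).1
  · filter_upwards [hsupp] with t ht z hz
    have hz' : y < z := hz
    rw [norm_neg, norm_mul, norm_mul, norm_mul, norm_mul, norm_exp, norm_exp]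
    simp only [neg_re, re_ofReal_mul, ofReal_re]
    gcongr
  · refine Eventually.of_forall fun t z _ => ?_
    have h0 : HasDerivAt (fun z : ℝ => (z : ℂ)) 1 z := (hasDerivAt_id _).comp_ofReal
    have h1 := ((((h0.mul_const (t : ℂ)).fun_neg).cexp).const_mul (g t)).const_mul ((t : ℂ) ^ n)
    refine h1.congr_deriv ?_
    ring

lemma iteratedDeriv_laplace (hsupp : ∀ᵐ t ∂μ, 0 ≤ t)
    (hint : ∀ x : ℝ, c < x → Integrable (fun t : ℝ => g t * exp (-(x * t))) μ) {W : ℝ → ℝ}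
    (hW : ∀ x : ℝ, c < x → (W x : ℂ) = ∫ t : ℝ, g t * exp (-(x * t)) ∂μ) (n : ℕ) :
    ∀ x : ℝ, c < x → ((iteratedDeriv n W x : ℝ) : ℂ) =
      (-1) ^ n * ∫ t : ℝ, (t : ℂ) ^ n * (g t * exp (-(x * t))) ∂μ := by
  induction n with
  | zero => intro x hx; simpa using hW x hx
  | succ n ih =>
    intro x hx
    set D : ℂ := (-1) ^ n * -∫ t : ℝ, (t : ℂ) ^ (n + 1) * (g t * exp (-(x * t))) ∂μ with hD
    have h1 : HasDerivAt (fun z : ℝ => ((iteratedDeriv n W z : ℝ) : ℂ)) D x :=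
      ((hasDerivAt_laplace_pow hsupp hint n hx).const_mul ((-1) ^ n)).congr_of_eventuallyEq (by
        filter_upwards [Ioi_mem_nhds hx] with z hz using ih z hz)
    have h2 : HasDerivAt (iteratedDeriv n W) D.re x := by
      have := (reCLM.hasFDerivAt.comp_hasDerivAt x h1)
      simpa [Function.comp_def] using this
    -- Being the derivative of a real function, `D` is real.
    have h3 := h1.unique h2.ofReal_comp
    rw [iteratedDeriv_succ, h2.deriv, ← h3, hD, pow_succ]
    ring

end LaplaceDerivatives

section Peak

lemma mul_exp_neg_div_lt {t t₁ : ℝ} (ht₁ : 0 < t₁) (ht : t ≠ t₁) :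
    t * Real.exp (-(t / t₁)) < t₁ * Real.exp (-(t₁ / t₁)) := by
  have h1 : t / t₁ - 1 ≠ 0 := fun h => ht ((div_eq_one_iff_eq ht₁.ne').1 (sub_eq_zero.1 h))
  have h2 := Real.add_one_lt_exp h1
  rw [sub_add_cancel, Real.exp_sub, div_lt_div_iff₀ ht₁ (Real.exp_pos _)] at h2
  rw [div_self ht₁.ne', Real.exp_neg, Real.exp_neg, ← div_eq_mul_inv, ← div_eq_mul_inv,
    div_lt_div_iff₀ (Real.exp_pos _) (Real.exp_pos _)]
  linarith

/-- From `1 + u ≤ e^u` at `u = (t - τ)/τ`. The sign condition covers both sides of the peak: `t ≤ τ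
≤ t₁` and `t₁ ≤ τ ≤ t`. -/
lemma mul_exp_neg_div_le {t τ t₁ : ℝ} (hτ : 0 < τ)
    (h : (t - τ) * (1 / τ - 1 / t₁) ≤ 0) :
    t * Real.exp (-(t / t₁)) ≤ τ * Real.exp (-(τ / t₁)) := by
  have h1 := Real.add_one_le_exp ((t - τ) / τ)
  have h2 : (t - τ) / τ + 1 = t / τ := by field_simp; ring
  rw [h2, div_le_iff₀ hτ] at h1
  calc t * Real.exp (-(t / t₁)) ≤ Real.exp ((t - τ) / τ) * τ * Real.exp (-(t / t₁)) := by gcongr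
    _ = τ * Real.exp ((t - τ) * (1 / τ - 1 / t₁) + -(τ / t₁)) := by
        rw [mul_comm _ τ, mul_assoc, ← Real.exp_add]; ring_nf
    _ ≤ _ := by
        apply mul_le_mul_of_nonneg_left (Real.exp_le_exp.2 _) hτ.le
        linarith

/-- Concentration of the kernels `(t exp(-t / t₁)) ^ n` at `t₁`. -/
lemma tendsto_integral_peak {μ : Measure ℝ} {f : ℝ → ℂ} {t₁ r : ℝ} (hr : 0 < r) (hrt : r < t₁)
    (hsupp : ∀ᵐ t ∂μ, 0 ≤ t)
    (hμ : μ.restrict (Set.Icc (t₁ - r) (t₁ + r)) = volume.restrict (Set.Icc (t₁ - r) (t₁ + r)))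
    (hf : Integrable f μ) (hcont : ContinuousAt f t₁) :
    Tendsto (fun n : ℕ => (∫ t in Set.Icc (t₁ - r) (t₁ + r), (t * Real.exp (-(t / t₁))) ^ n)⁻¹ •
      ∫ t, (t * Real.exp (-(t / t₁))) ^ n • f t ∂μ) atTop (𝓝 (f t₁)) := by
  have ht₁ : 0 < t₁ := hr.trans hrt
  set k : ℝ → ℝ := fun t => t * Real.exp (-(t / t₁)) with hk
  set K := Set.Icc (t₁ - r) (t₁ + r) with hK
  set Z : ℕ → ℝ := fun n => ∫ t in K, k t ^ n with hZ
  have hkc : Continuous k := by fun_prop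
  have hk0 : ∀ t, 0 ≤ t → 0 ≤ k t := fun t ht => mul_nonneg ht (Real.exp_pos _).le
  have hkle : ∀ t, k t ≤ k t₁ := fun t => by
    by_cases h : t = t₁
    · rw [h]
    · exact (mul_exp_neg_div_lt ht₁ h).le
  have hmain : Tendsto (fun n : ℕ => (Z n)⁻¹ • ∫ t in K, k t ^ n • f t) atTop (𝓝 (f t₁)) := by
    refine tendsto_setIntegral_pow_smul_of_unique_maximum_of_isCompact_of_integrableOn
      isCompact_Icc hkc.continuousOn (fun y _ hy => mul_exp_neg_div_lt ht₁ hy)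
      (fun t ht => hk0 t (by linarith [ht.1])) (by positivity) ?_ ?_ hcont.continuousWithinAt
    · rw [interior_Icc, closure_Ioo (by linarith)]
      exact ⟨by linarith, by linarith⟩
    · rw [IntegrableOn, ← hμ]; exact hf.restrict
  set Q : ℝ := max (k (t₁ - r)) (k (t₁ + r)) with hQ
  have hQlt : Q < k t₁ := max_lt (mul_exp_neg_div_lt ht₁ (by linarith))
    (mul_exp_neg_div_lt ht₁ (by linarith))
  have hQ0 : 0 ≤ Q := le_max_of_le_right (hk0 _ (by linarith))
  have hout : ∀ t, t ∉ K → k t ≤ Q := by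
    intro t ht
    rw [hK, Set.mem_Icc, not_and_or, not_le, not_le] at ht
    rcases ht with ht | ht
    · refine le_trans (mul_exp_neg_div_le (by linarith) ?_) (le_max_left _ _)
      refine mul_nonpos_of_nonpos_of_nonneg (by linarith) (sub_nonneg.2 ?_)
      exact one_div_le_one_div_of_le (by linarith) (by linarith)
    · refine le_trans (mul_exp_neg_div_le (by linarith) ?_) (le_max_right _ _)
      refine mul_nonpos_of_nonneg_of_nonpos (by linarith) (sub_nonpos.2 ?_)
      exact one_div_le_one_div_of_le (by linarith) (by linarith)
  -- Off `K` the kernel is at most `Q^n`, while the normalizing integral is at least `2η q^n` with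
  -- `q > Q`. The tail therefore vanishes like `(Q/q)^n`.
  obtain ⟨q, hQq, hqk⟩ := exists_between hQlt
  have hq0 : 0 < q := hQ0.trans_lt hQq
  obtain ⟨ε, hε, hεq⟩ := Metric.eventually_nhds_iff.1 (hkc.continuousAt.eventually_const_lt hqk)
  set η := min (ε / 2) r with hη
  have hηpos : 0 < η := lt_min (by linarith) hr
  have hsub : Set.Icc (t₁ - η) (t₁ + η) ⊆ K :=
    Set.Icc_subset_Icc (by linarith [min_le_right (ε / 2) r]) (by linarith [min_le_right (ε / 2) r])
  have hZint : ∀ n, IntegrableOn (fun t => k t ^ n) K := fun n =>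
    (hkc.pow n).continuousOn.integrableOn_compact isCompact_Icc
  have hZge : ∀ n, 2 * η * q ^ n ≤ Z n := by
    intro n
    have h1 : ∫ _ in Set.Icc (t₁ - η) (t₁ + η), q ^ n = 2 * η * q ^ n := by
      rw [setIntegral_const, measureReal_def, Real.volume_Icc, ENNReal.toReal_ofReal (by linarith),
        smul_eq_mul]
      ring
    rw [← h1]
    refine le_trans (setIntegral_mono_on (g := fun t => k t ^ n) (by simp)
      ((hZint n).mono_set hsub) measurableSet_Icc fun t ht => ?_) ?_
    · refine pow_le_pow_left₀ hq0.le (hεq ?_).le n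
      rw [Real.dist_eq, abs_lt]
      have := min_le_left (ε / 2) r
      constructor <;> linarith [ht.1, ht.2]
    · refine setIntegral_mono_set (hZint n) ?_ hsub.eventuallyLE
      exact (ae_restrict_iff' measurableSet_Icc).2 (Eventually.of_forall fun t ht =>
        pow_nonneg (hk0 t (by linarith [ht.1])) n)
  have htail : Tendsto (fun n : ℕ => (Z n)⁻¹ • ∫ t in Kᶜ, k t ^ n • f t ∂μ) atTop (𝓝 0) := by
    have hz : Tendsto (fun n : ℕ => (Q / q) ^ n * ((2 * η)⁻¹ * ∫ t, ‖f t‖ ∂μ)) atTop (𝓝 0) := by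
      simpa using (tendsto_pow_atTop_nhds_zero_of_lt_one (by positivity)
        ((div_lt_one hq0).2 hQq)).mul_const ((2 * η)⁻¹ * ∫ t, ‖f t‖ ∂μ)
    refine squeeze_zero_norm (fun n => ?_) hz
    have h1 : ‖∫ t in Kᶜ, k t ^ n • f t ∂μ‖ ≤ Q ^ n * ∫ t, ‖f t‖ ∂μ := by
      rw [← integral_const_mul]
      refine le_trans (norm_integral_le_of_norm_le (hf.norm.const_mul (Q ^ n)).integrableOn ?_)
        (setIntegral_le_integral (hf.norm.const_mul (Q ^ n))
          (Eventually.of_forall fun t => by simp only [Pi.zero_apply]; positivity))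
      rw [ae_restrict_iff' measurableSet_Icc.compl]
      filter_upwards [hsupp] with t ht htK
      rw [norm_smul, norm_pow, Real.norm_of_nonneg (hk0 t ht)]
      exact mul_le_mul_of_nonneg_right (pow_le_pow_left₀ (hk0 t ht) (hout t htK) n) (norm_nonneg _)
    have h2 : 0 < 2 * η * q ^ n := by positivity
    have h3 : 0 < Z n := h2.trans_le (hZge n)
    rw [norm_smul, norm_inv, Real.norm_of_nonneg h3.le]
    calc _ ≤ (2 * η * q ^ n)⁻¹ * (Q ^ n * ∫ t, ‖f t‖ ∂μ) := by
          gcongr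
          exact hZge n
      _ = _ := by rw [div_pow]; field_simp
  have hsum := hmain.add htail
  rw [add_zero] at hsum
  refine hsum.congr fun n => ?_
  rw [← smul_add]
  have hK' : ∫ t in K, k t ^ n • f t = ∫ t in K, k t ^ n • f t ∂μ := by rw [hK, hμ]
  rw [hK']
  have hint : Integrable (fun t => k t ^ n • f t) μ := by
    refine Integrable.mono' (hf.norm.const_mul (k t₁ ^ n))
      ((hkc.pow n).aestronglyMeasurable.smul hf.1) ?_
    filter_upwards [hsupp] with t ht
    rw [norm_smul, norm_pow, Real.norm_of_nonneg (hk0 t ht)]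
    exact mul_le_mul_of_nonneg_right (pow_le_pow_left₀ (hk0 t ht) (hkle t) n) (norm_nonneg _)
  rw [integral_add_compl measurableSet_Icc hint]

/-- If the Laplace transform of `g` has the sign pattern of a completely monotonic function, then
`g` is real and nonnegative at its points of continuity. -/
theorem nonneg_of_laplace_iteratedDeriv {μ : Measure ℝ} {g : ℝ → ℂ} {c t₁ r : ℝ} {W : ℝ → ℝ}
    (hr : 0 < r) (hrt : r < t₁) (hsupp : ∀ᵐ t ∂μ, 0 ≤ t)
    (hμ : μ.restrict (Set.Icc (t₁ - r) (t₁ + r)) = volume.restrict (Set.Icc (t₁ - r) (t₁ + r)))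
    (hint : ∀ x : ℝ, c < x → Integrable (fun t : ℝ => g t * exp (-(x * t))) μ)
    (hW : ∀ x : ℝ, c < x → (W x : ℂ) = ∫ t : ℝ, g t * exp (-(x * t)) ∂μ)
    (hcm : ∀ (n : ℕ) (x : ℝ), c < x → 0 ≤ (-1 : ℝ) ^ n * iteratedDeriv n W x)
    (hcont : ContinuousAt g t₁) : (g t₁).im = 0 ∧ 0 ≤ (g t₁).re := by
  have ht₁ : 0 < t₁ := hr.trans hrt
  set x₀ : ℝ := c + 1 with hx₀
  have hf := hint x₀ (by linarith)
  have hlim := tendsto_integral_peak hr hrt hsupp hμ hf (hcont.mul (by fun_prop))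
  -- Differentiating at `x₀ + n/t₁` produces the `n`-th power of the peak kernel and leaves the
  -- fixed factor `e^(-x₀t)`.
  have hval : ∀ n : ℕ, ∫ t : ℝ, (t * Real.exp (-(t / t₁))) ^ n • (g t * exp (-(x₀ * t))) ∂μ =
      (((-1 : ℝ) ^ n * iteratedDeriv n W (x₀ + n / t₁) : ℝ) : ℂ) := by
    intro n
    have h0 : (0 : ℝ) ≤ n / t₁ := by positivity
    rw [ofReal_mul, iteratedDeriv_laplace hsupp hint hW n _ (by linarith), ← mul_assoc]
    push_cast
    rw [← mul_pow, neg_one_mul, neg_neg, one_pow, one_mul]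
    refine integral_congr_ae (Eventually.of_forall fun t => ?_)
    simp only [real_smul]
    push_cast
    rw [mul_pow, ← exp_nat_mul, mul_assoc, mul_left_comm (exp _) (g t), ← exp_add]
    congr 3
    field_simp
    ring
  simp_rw [hval, real_smul, ← ofReal_mul] at hlim
  have hexp : g t₁ * exp (-((x₀ * t₁ : ℝ) : ℂ)) = ((Real.exp (-(x₀ * t₁)) : ℝ) : ℂ) * g t₁ := by
    push_cast; ring
  rw [hexp] at hlim
  have him := (continuous_im.tendsto _).comp hlim
  have hre := (continuous_re.tendsto _).comp hlim
  simp only [Function.comp_def, ofReal_im, ofReal_re, im_ofReal_mul, re_ofReal_mul] at him hre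
  have hpos : 0 < Real.exp (-(x₀ * t₁)) := Real.exp_pos _
  constructor
  · have := tendsto_nhds_unique him tendsto_const_nhds
    exact (mul_eq_zero.1 this).resolve_left hpos.ne'
  · refine nonneg_of_mul_nonneg_right (ge_of_tendsto' hre fun n => mul_nonneg ?_ ?_) hpos
    · refine inv_nonneg.2 (setIntegral_nonneg measurableSet_Icc fun t ht => ?_)
      have : 0 ≤ t := by linarith [ht.1]
      positivity
    · have h0 : (0 : ℝ) ≤ n / t₁ := by positivity
      exact hcm n _ (by linarith)

end Peak

end FoxH

/-! ### Landau's theorem, analytic continuation and uniqueness. -/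

namespace FoxH

open Complex Filter Topology MeasureTheory ProbabilityTheory

section Landau

variable {m : Measure ℝ} {c : ℝ} {W : ℝ → ℝ}

/-- To the left of `x₀` the sign of `(x - x₀)^(N+1)` matches that of the derivative, so Lagrange's
remainder is nonnegative. -/
lemma taylor_le_of_isCompletelyMonotonic (hW : IsCompletelyMonotonic W) {x x₀ : ℝ} (hx : 0 < x)
    (hxx₀ : x < x₀) (N : ℕ) :
    ∑ k ∈ Finset.range (N + 1), ((k.factorial : ℝ)⁻¹ * (x - x₀) ^ k) * iteratedDeriv k W x₀ ≤
      W x := by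
  have hsub : Set.uIcc x₀ x ⊆ Set.Ioi 0 := by
    rw [Set.uIcc_of_ge hxx₀.le]
    exact fun y hy => hx.trans_le hy.1
  have hcd : ContDiffOn ℝ (N + 1) W (Set.uIcc x₀ x) :=
    (hW.2.1.mono hsub).of_le (by exact_mod_cast le_top)
  obtain ⟨y, hy, hval⟩ := taylor_mean_remainder_lagrange_iteratedDeriv hxx₀.ne' hcd
  have hy0 : 0 < y := by
    rw [Set.uIoo_of_ge hxx₀.le] at hy
    exact hx.trans hy.1
  have hrem : 0 ≤ iteratedDeriv (N + 1) W y * (x - x₀) ^ (N + 1) / (N + 1).factorial := by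
    have h1 := hW.2.2 (N + 1) y hy0
    have h2 : (x - x₀) ^ (N + 1) = (-1) ^ (N + 1) * (x₀ - x) ^ (N + 1) := by
      rw [← mul_pow]; ring
    rw [h2, ← mul_assoc, mul_comm (iteratedDeriv _ _ _)]
    have h3 : 0 ≤ (x₀ - x) ^ (N + 1) := pow_nonneg (by linarith) _
    positivity
  rw [← hval, taylor_within_apply, sub_nonneg] at hrem
  refine le_trans (le_of_eq (Finset.sum_congr rfl fun k _ => ?_)) hrem
  rw [iteratedDerivWithin_eq_iteratedDeriv (uniqueDiffOn_uIcc hxx₀.ne') _ Set.left_mem_uIcc,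
    smul_eq_mul]
  exact ((hW.2.1.contDiffAt (Ioi_mem_nhds (hx.trans hxx₀))).of_le (by exact_mod_cast le_top))

/-- Landau's theorem for completely monotonic functions: the Laplace integral of a positive
measure converges as far to the left as the function is completely monotonic. -/
theorem integrable_exp_of_isCompletelyMonotonic (hW : IsCompletelyMonotonic W)
    (hsupp : ∀ᵐ t ∂m, 0 ≤ t)
    (hint : ∀ x : ℝ, c < x → Integrable (fun t : ℝ => Real.exp (-(x * t))) m)
    (hrep : ∀ x : ℝ, c < x → W x = ∫ t, Real.exp (-(x * t)) ∂m) {x : ℝ} (hx : 0 < x) :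
    Integrable (fun t : ℝ => Real.exp (-(x * t))) m := by
  by_cases hcx : c < x
  · exact hint x hcx
  set x₀ : ℝ := c + 1 with hx₀
  have hxx₀ : x < x₀ := by linarith
  have hintC : ∀ x : ℝ, c < x → Integrable (fun t : ℝ => (1 : ℂ) * exp (-(x * t))) m :=
    fun x hx => by
      refine (hint x hx).ofReal.congr (Eventually.of_forall fun t => ?_)
      simp
  have hrepC : ∀ x : ℝ, c < x → (W x : ℂ) = ∫ t : ℝ, (1 : ℂ) * exp (-(x * t)) ∂m :=
    fun x hx => by
      rw [hrep x hx, ← integral_complex_ofReal]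
      refine integral_congr_ae (Eventually.of_forall fun t => ?_)
      simp
  have hpowint : ∀ n : ℕ, Integrable (fun t : ℝ => t ^ n * Real.exp (-(x₀ * t))) m := fun n => by
    refine (integrable_pow_mul_laplace hsupp hintC n (x := x₀) (by linarith)).re.congr
      (Eventually.of_forall fun t => ?_)
    have : (t : ℂ) ^ n * (1 * exp (-(x₀ * t))) = ((t ^ n * Real.exp (-(x₀ * t)) : ℝ) : ℂ) := by
      push_cast; ring
    simp only [this, RCLike.re_to_complex, ofReal_re]
  have hder : ∀ n : ℕ, iteratedDeriv n W x₀ =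
      (-1) ^ n * ∫ t, t ^ n * Real.exp (-(x₀ * t)) ∂m := fun n => by
    have h1 := iteratedDeriv_laplace hsupp hintC hrepC n x₀ (by linarith)
    have h2 : ∫ t : ℝ, (t : ℂ) ^ n * (1 * exp (-(x₀ * t))) ∂m =
        ((∫ t, t ^ n * Real.exp (-(x₀ * t)) ∂m : ℝ) : ℂ) := by
      rw [← integral_complex_ofReal]
      refine integral_congr_ae (Eventually.of_forall fun t => ?_)
      simp
    rw [h2] at h1
    exact_mod_cast h1
  -- Partial sums of `e^((x₀ - x)t)` times `e^(-x₀t)`. On `t ≥ 0` they increase to `e^(-xt)`, and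
  -- their integrals are the Taylor sums of `W` at `x₀`, bounded by `W x`.
  set S : ℕ → ℝ → ℝ := fun N t =>
    ∑ k ∈ Finset.range (N + 1), ((x₀ - x) * t) ^ k / k.factorial * Real.exp (-(x₀ * t)) with hS
  have hSterm : ∀ (k : ℕ) (t : ℝ), ((x₀ - x) * t) ^ k / k.factorial * Real.exp (-(x₀ * t)) =
      (x₀ - x) ^ k / k.factorial * (t ^ k * Real.exp (-(x₀ * t))) := fun k t => by
    rw [mul_pow]; ring
  have hSint : ∀ N, Integrable (S N) m := fun N => by
    refine integrable_finsetSum _ fun k _ => ?_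
    simp_rw [hSterm]
    exact (hpowint k).const_mul _
  have hS0 : ∀ (k : ℕ) (t : ℝ), 0 ≤ t →
      0 ≤ ((x₀ - x) * t) ^ k / k.factorial * Real.exp (-(x₀ * t)) := fun k t ht => by
    have : 0 ≤ (x₀ - x) * t := mul_nonneg (by linarith) ht
    positivity
  have hSle : ∀ N, ∫⁻ t, ENNReal.ofReal (S N t) ∂m ≤ ENNReal.ofReal (W x) := fun N => by
    rw [← ofReal_integral_eq_lintegral_ofReal (hSint N)
      (hsupp.mono fun t ht => Finset.sum_nonneg fun k _ => hS0 k t ht)]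
    refine ENNReal.ofReal_le_ofReal ?_
    rw [integral_finsetSum _ fun k _ => by simp_rw [hSterm]; exact (hpowint k).const_mul _]
    refine le_trans (le_of_eq (Finset.sum_congr rfl fun k _ => ?_))
      (taylor_le_of_isCompletelyMonotonic hW hx hxx₀ N)
    simp_rw [hSterm]
    rw [integral_const_mul, hder k]
    have : (x - x₀) ^ k = (-1) ^ k * (x₀ - x) ^ k := by rw [← mul_pow]; ring
    have h1 : ((-1 : ℝ)) ^ k * (-1) ^ k = 1 := by rw [← mul_pow]; simp
    rw [this]
    linear_combination (-(x₀ - x) ^ k / k.factorial *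
      ∫ t, t ^ k * Real.exp (-(x₀ * t)) ∂m) * h1
  have hlim := lintegral_tendsto_of_tendsto_of_monotone (μ := m)
    (f := fun N t => ENNReal.ofReal (S N t)) (F := fun t => ENNReal.ofReal (Real.exp (-(x * t))))
    (fun N => (hSint N).1.aemeasurable.ennreal_ofReal)
    (hsupp.mono fun t ht => monotone_nat_of_le_succ fun N => ENNReal.ofReal_le_ofReal (by
      rw [hS]
      simp only
      rw [Finset.sum_range_succ _ (N + 1)]
      exact le_add_of_nonneg_right (hS0 _ t ht)))
    (Eventually.of_forall fun t => by
      refine (ENNReal.continuous_ofReal.tendsto _).comp ?_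
      have h1 := (NormedSpace.expSeries_div_hasSum_exp ((x₀ - x) * t)).mul_right
        (Real.exp (-(x₀ * t)))
      rw [← Real.exp_eq_exp_ℝ, ← Real.exp_add] at h1
      have h2 := h1.tendsto_sum_nat.comp (tendsto_add_atTop_nat 1)
      rwa [show (x₀ - x) * t + -(x₀ * t) = -(x * t) by ring] at h2)
  have hle := le_of_tendsto' hlim hSle
  refine ⟨(by fun_prop : Continuous fun t : ℝ => Real.exp (-(x * t))).aestronglyMeasurable, ?_⟩
  rw [hasFiniteIntegral_iff_ofReal (Eventually.of_forall fun t => (Real.exp_pos _).le)]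
  exact hle.trans_lt ENNReal.ofReal_lt_top

end Landau

section Continuation

lemma mem_interior_integrableExpSet {m : Measure ℝ}
    (hint : ∀ x : ℝ, 0 < x → Integrable (fun t : ℝ => Real.exp (-(x * t))) m) {y : ℝ} (hy : y < 0) :
    y ∈ interior (integrableExpSet id m) := by
  have hsub : Set.Iio (0 : ℝ) ⊆ integrableExpSet id m := fun z hz => by
    have := hint (-z) (neg_pos.2 hz)
    simpa [integrableExpSet] using this
  exact interior_maximal hsub isOpen_Iio hy

lemma differentiableOn_laplace {m : Measure ℝ}
    (hint : ∀ x : ℝ, 0 < x → Integrable (fun t : ℝ => Real.exp (-(x * t))) m) :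
    DifferentiableOn ℂ (fun z : ℂ => ∫ t : ℝ, exp (-(z * t)) ∂m) {z | 0 < z.re} := by
  have h1 := (differentiableOn_complexMGF (X := id) (μ := m)).comp
    (s := {z : ℂ | 0 < z.re}) (f := fun z : ℂ => -z) differentiable_id.neg.differentiableOn
    (fun z hz => mem_interior_integrableExpSet hint (y := (-z).re) (neg_neg_of_pos hz))
  refine h1.congr fun z _ => ?_
  simp [complexMGF]

/-- The identity theorem on the right half-plane, for functions that agree on a real half-line. -/
lemma eqOn_halfPlane {f g : ℂ → ℂ} (hf : DifferentiableOn ℂ f {z | 0 < z.re})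
    (hg : DifferentiableOn ℂ g {z | 0 < z.re}) {c : ℝ} (h : ∀ x : ℝ, c < x → f x = g x) :
    Set.EqOn f g {z | 0 < z.re} := by
  have hopen : IsOpen {z : ℂ | 0 < z.re} := isOpen_lt continuous_const continuous_re
  have hconv : Convex ℝ {z : ℂ | 0 < z.re} := convex_halfSpace_re_gt 0
  set y : ℝ := max c 0 + 1 with hy
  have hy0 : 0 < y := by positivity
  refine AnalyticOnNhd.eqOn_of_preconnected_of_frequently_eq (hf.analyticOnNhd hopen)
    (hg.analyticOnNhd hopen) hconv.isPreconnected (z₀ := (y : ℂ)) (by simpa using hy0) ?_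
  have hev : ∀ᶠ x : ℝ in 𝓝[≠] y, f x = g x := by
    refine eventually_nhdsWithin_of_eventually_nhds ?_
    filter_upwards [Ioi_mem_nhds (show c < y by linarith [le_max_left c 0])] with x hx using h x hx
  have htend : Tendsto (fun x : ℝ => (x : ℂ)) (𝓝[≠] y) (𝓝[≠] (y : ℂ)) := by
    refine tendsto_nhdsWithin_iff.2 ⟨(continuous_ofReal.tendsto y).mono_left nhdsWithin_le_nhds, ?_⟩
    filter_upwards [self_mem_nhdsWithin] with x hx
    simpa using hx
  exact htend.frequently hev.frequently

lemma integral_exp_ofReal (m : Measure ℝ) (x : ℝ) : ∫ t : ℝ, exp (-((x : ℂ) * t)) ∂m =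
    ((∫ t, Real.exp (-(x * t)) ∂m : ℝ) : ℂ) := by
  rw [← integral_complex_ofReal]
  refine integral_congr_ae (Eventually.of_forall fun t => ?_)
  simp

/-- Uniqueness of the measure with a given Laplace transform on `(0, ∞)`. -/
theorem measure_ext_of_laplace {m₁ m₂ : Measure ℝ}
    (h₁ : ∀ x : ℝ, 0 < x → Integrable (fun t : ℝ => Real.exp (-(x * t))) m₁)
    (h₂ : ∀ x : ℝ, 0 < x → Integrable (fun t : ℝ => Real.exp (-(x * t))) m₂)
    (h : ∀ x : ℝ, 0 < x → ∫ t, Real.exp (-(x * t)) ∂m₁ = ∫ t, Real.exp (-(x * t)) ∂m₂) :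
    m₁ = m₂ := by
  have heq := eqOn_halfPlane (differentiableOn_laplace h₁) (differentiableOn_laplace h₂) (c := 0)
    fun x hx => by rw [integral_exp_ofReal, integral_exp_ofReal, h x hx]
  -- Tilting by `e^(-t)` makes the measures finite, and their characteristic functions are the
  -- Laplace transforms on `Re z = 1`. The density vanishes nowhere, so the tilt can be undone.
  set w : ℝ → ENNReal := fun t => ENNReal.ofReal (Real.exp (-(1 * t))) with hw
  have hwm : Measurable w := by fun_prop
  have hw0 : ∀ t, w t ≠ 0 := fun t => (ENNReal.ofReal_pos.2 (Real.exp_pos _)).ne'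
  have hwt : ∀ t, w t ≠ ⊤ := fun t => ENNReal.ofReal_ne_top
  have hfin₁ : IsFiniteMeasure (m₁.withDensity w) :=
    isFiniteMeasure_withDensity_ofReal (h₁ 1 one_pos).2
  have hfin₂ : IsFiniteMeasure (m₂.withDensity w) :=
    isFiniteMeasure_withDensity_ofReal (h₂ 1 one_pos).2
  have hchar : ∀ (m : Measure ℝ) (u : ℝ), charFun (m.withDensity w) u =
      ∫ t : ℝ, exp (-((1 - u * I) * t)) ∂m := fun m u => by
    rw [charFun_apply_real, integral_withDensity_eq_integral_toReal_smul hwm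
      (Eventually.of_forall fun t => (hwt t).lt_top)]
    refine integral_congr_ae (Eventually.of_forall fun t => ?_)
    simp only [hw]
    rw [ENNReal.toReal_ofReal (Real.exp_pos _).le, real_smul, ofReal_exp, ← exp_add]
    congr 1
    push_cast
    ring
  have hwd : m₁.withDensity w = m₂.withDensity w := by
    refine Measure.ext_of_charFun (funext fun u => ?_)
    rw [hchar, hchar]
    exact heq (by simp)
  rw [← withDensity_inv_same (μ := m₁) hwm (Eventually.of_forall hw0) (Eventually.of_forall hwt),
    hwd, withDensity_inv_same hwm (Eventually.of_forall hw0) (Eventually.of_forall hwt)]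

end Continuation

end FoxH

/-! ### The representing measure, positivity of `H`, and continuation to the half-line. -/

namespace FoxH

open Complex Filter Topology MeasureTheory

section AtomAndDensity

/-- Unit mass at `t₀` plus Lebesgue measure on `(t₀, ∞)`. -/
noncomputable def atomAndLebesgue (t₀ : ℝ) : Measure ℝ :=
  Measure.dirac t₀ + volume.restrict (Set.Ioi t₀)

lemma ae_atomAndLebesgue {t₀ : ℝ} {P : ℝ → Prop} (h : ∀ t, t₀ ≤ t → P t) :
    ∀ᵐ t ∂atomAndLebesgue t₀, P t := by
  rw [atomAndLebesgue, ae_add_measure_iff]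
  refine ⟨?_, ?_⟩
  · rw [ae_dirac_eq]; exact h t₀ le_rfl
  · rw [ae_restrict_iff' measurableSet_Ioi]
    exact Eventually.of_forall fun t ht => h t (le_of_lt ht)

lemma atomAndLebesgue_restrict_Icc {t₀ t r : ℝ} (h : t₀ < t - r) :
    (atomAndLebesgue t₀).restrict (Set.Icc (t - r) (t + r)) =
      volume.restrict (Set.Icc (t - r) (t + r)) := by
  have h1 : (Measure.dirac t₀).restrict (Set.Icc (t - r) (t + r)) = 0 := by
    rw [Measure.restrict_eq_zero, Measure.dirac_apply' _ measurableSet_Icc,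
      Set.indicator_of_notMem fun hm => absurd hm.1 (not_le.2 h)]
  rw [atomAndLebesgue, Measure.restrict_add, h1, zero_add,
    Measure.restrict_restrict measurableSet_Icc, Set.inter_eq_left.2]
  exact fun s hs => h.trans_le hs.1

/-- `h`, with the value `ν` at `t₀`. -/
noncomputable def withAtom (t₀ : ℝ) (ν : ℂ) (h : ℝ → ℂ) : ℝ → ℂ := Function.update h t₀ ν

lemma withAtom_of_gt {t₀ t : ℝ} (ν : ℂ) (h : ℝ → ℂ) (ht : t₀ < t) : withAtom t₀ ν h t = h t :=
  Function.update_of_ne ht.ne' _ _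

lemma withAtom_ae_eq (t₀ : ℝ) (ν : ℂ) (h e : ℝ → ℂ) :
    (fun t => withAtom t₀ ν h t * e t) =ᵐ[volume.restrict (Set.Ioi t₀)] fun t => h t * e t := by
  filter_upwards [ae_restrict_mem measurableSet_Ioi] with t ht
  rw [withAtom_of_gt ν h ht]

lemma integrable_withAtom {t₀ : ℝ} {ν : ℂ} {h e : ℝ → ℂ}
    (hi : IntegrableOn (fun t => h t * e t) (Set.Ioi t₀)) :
    Integrable (fun t => withAtom t₀ ν h t * e t) (atomAndLebesgue t₀) := by
  rw [atomAndLebesgue, integrable_add_measure]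
  exact ⟨integrable_dirac enorm_lt_top, (integrable_congr (withAtom_ae_eq t₀ ν h e)).2 hi⟩

lemma integral_withAtom {t₀ : ℝ} {ν : ℂ} {h e : ℝ → ℂ}
    (hi : IntegrableOn (fun t => h t * e t) (Set.Ioi t₀)) :
    ∫ t, withAtom t₀ ν h t * e t ∂atomAndLebesgue t₀ =
      ν * e t₀ + ∫ t in Set.Ioi t₀, h t * e t := by
  have := integrable_withAtom (ν := ν) hi
  rw [atomAndLebesgue, integrable_add_measure] at this
  rw [atomAndLebesgue, integral_add_measure this.1 this.2, integral_dirac,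
    integral_congr_ae (withAtom_ae_eq t₀ ν h e), withAtom, Function.update_self]

end AtomAndDensity

section Representation

variable {p q : ℕ} {A a : Fin p → ℝ} {B b : Fin q → ℝ} {c φ₁ φ₂ : ℝ}

lemma reprMeasure_Iio (c φ₁ φ₂ : ℝ) (A a : Fin p → ℝ) (B b : Fin q → ℝ) :
    reprMeasure c φ₁ φ₂ A a B b (Set.Iio (-Real.log (rho A B))) = 0 := by
  have h1 : (volume.restrict (Set.Ici (-Real.log (rho A B)))) (Set.Iio (-Real.log (rho A B))) = 0 := by
    rw [Measure.restrict_apply measurableSet_Iio, Set.Iio_inter_Ici, Set.Ico_self, measure_empty]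
  rw [reprMeasure, Measure.add_apply, Measure.smul_apply, Measure.dirac_apply' _ measurableSet_Iio,
    Set.indicator_of_notMem (by simp), smul_zero, zero_add]
  exact withDensity_absolutelyContinuous _ _ h1

lemma reprMeasure_restrict_Ici (c φ₁ φ₂ : ℝ) (A a : Fin p → ℝ) (B b : Fin q → ℝ) :
    (reprMeasure c φ₁ φ₂ A a B b).restrict (Set.Ici (-Real.log (rho A B))) =
      reprMeasure c φ₁ φ₂ A a B b := by
  refine Measure.restrict_eq_self_of_ae_mem ?_
  rw [ae_iff]
  convert reprMeasure_Iio c φ₁ φ₂ A a B b using 2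
  ext t
  simp

/-- Integrals against the representing measure, when `H` is real and nonnegative. -/
lemma laplace_reprMeasure (hA : ∀ k, 0 < A k) (hB : ∀ j, 0 < B j)
    (hcont : ContinuousOn (fun t : ℝ => foxH c φ₁ φ₂ A a B b (Real.exp (-t)))
      (Set.Ioi (-Real.log (rho A B))))
    (hH : ∀ t : ℝ, -Real.log (rho A B) < t → (foxH c φ₁ φ₂ A a B b (Real.exp (-t))).im = 0 ∧
      0 ≤ (foxH c φ₁ φ₂ A a B b (Real.exp (-t))).re) {x : ℝ}
    (hi : IntegrableOn (fun t : ℝ => foxH c φ₁ φ₂ A a B b (Real.exp (-t)) * exp (-(x * t)))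
        (Set.Ioi (-Real.log (rho A B)))) :
    Integrable (fun t : ℝ => Real.exp (-(x * t))) (reprMeasure c φ₁ φ₂ A a B b) ∧
      ((∫ t, Real.exp (-(x * t)) ∂reprMeasure c φ₁ φ₂ A a B b : ℝ) : ℂ) =
        nu A a B b * exp (-(x * (-Real.log (rho A B) : ℝ))) +
        ∫ t in Set.Ioi (-Real.log (rho A B)),
          foxH c φ₁ φ₂ A a B b (Real.exp (-t)) * exp (-(x * t)) := by
  set t₀ := -Real.log (rho A B) with ht₀
  set H : ℝ → ℂ := fun t => foxH c φ₁ φ₂ A a B b (Real.exp (-t)) with hHdef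
  set e : ℝ → ℝ := fun t => Real.exp (-(x * t)) with he
  have hν := nu_pos hA hB a b
  have hm : AEMeasurable (fun t => ENNReal.ofReal (H t).re) (volume.restrict (Set.Ioi t₀)) :=
    ((continuous_re.comp_continuousOn hcont).aemeasurable measurableSet_Ioi).ennreal_ofReal
  have hlt : ∀ᵐ t ∂volume.restrict (Set.Ioi t₀), ENNReal.ofReal (H t).re < ⊤ :=
    Eventually.of_forall fun t => ENNReal.ofReal_lt_top
  have hae : (fun t => ((ENNReal.ofReal (H t).re).toReal • e t : ℝ)) =ᵐ[volume.restrict (Set.Ioi t₀)]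
      fun t => (H t * exp (-(x * t))).re := by
    filter_upwards [ae_restrict_mem measurableSet_Ioi] with t ht
    have hexp : exp (-((x : ℂ) * t)) = ((e t : ℝ) : ℂ) := by rw [he]; push_cast; rfl
    rw [ENNReal.toReal_ofReal (hH t ht).2, hexp, re_mul_ofReal, smul_eq_mul]
  have haeC : (fun t => (((H t * exp (-(x * t))).re : ℝ) : ℂ)) =ᵐ[volume.restrict (Set.Ioi t₀)]
      fun t => H t * exp (-(x * t)) := by
    filter_upwards [ae_restrict_mem measurableSet_Ioi] with t ht
    have hexp : exp (-((x : ℂ) * t)) = ((e t : ℝ) : ℂ) := by rw [he]; push_cast; rfl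
    apply Complex.ext
    · simp
    · rw [ofReal_im, hexp, im_mul_ofReal, (hH t ht).1, zero_mul]
  have hi1 : Integrable e (ENNReal.ofReal (nu A a B b) • Measure.dirac t₀) :=
    (integrable_dirac (by simp)).smul_measure ENNReal.ofReal_ne_top
  have hi2 : Integrable e ((volume.restrict (Set.Ioi t₀)).withDensity
      fun t => ENNReal.ofReal (H t).re) := by
    rw [integrable_withDensity_iff_integrable_smul₀' hm hlt, integrable_congr hae]
    exact hi.re
  have hrepr : reprMeasure c φ₁ φ₂ A a B b = ENNReal.ofReal (nu A a B b) • Measure.dirac t₀ +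
      (volume.restrict (Set.Ioi t₀)).withDensity fun t => ENNReal.ofReal (H t).re := by
    -- The endpoint is Lebesgue-null; it is dropped because continuity of `H` is known only on the
    -- open half-line.
    rw [reprMeasure, ← ht₀, restrict_Ioi_eq_restrict_Ici]
  rw [hrepr]
  refine ⟨integrable_add_measure.2 ⟨hi1, hi2⟩, ?_⟩
  rw [integral_add_measure hi1 hi2, integral_smul_measure, integral_dirac,
    integral_withDensity_eq_integral_toReal_smul₀ hm hlt, integral_congr_ae hae,
    ENNReal.toReal_ofReal hν.le, ofReal_add, ← integral_complex_ofReal, integral_congr_ae haeC,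
    smul_eq_mul, he]
  push_cast
  rfl

lemma foxH_nonneg (hA : ∀ k, 0 < A k) (hB : ∀ j, 0 < B j) (hΔ : (∑ j, B j) - (∑ k, A k) = 0)
    (hμ : mu a b = 0) (hρ : rho A B ≤ 1) {W : ℝ → ℝ}
    (hW : ∀ x : ℝ, max c 0 < x → W x = gammaRatio A a B b x) (hWcm : IsCompletelyMonotonic W)
    (hφ₁ : φ₁ < 0) (hφ₂ : 0 < φ₂) (hc : ∀ k, -a k / A k < c) {t : ℝ}
    (ht : -Real.log (rho A B) < t) :
    (foxH c φ₁ φ₂ A a B b (Real.exp (-t))).im = 0 ∧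
      0 ≤ (foxH c φ₁ φ₂ A a B b (Real.exp (-t))).re := by
  set t₀ := -Real.log (rho A B) with ht₀
  have ht₀0 : 0 ≤ t₀ := neg_nonneg.2 (Real.log_nonpos (rho_pos hA hB).le hρ)
  set H : ℝ → ℂ := fun t => foxH c φ₁ φ₂ A a B b (Real.exp (-t)) with hHdef
  have hcont : ContinuousOn H (Set.Ioi t₀) := continuousOn_foxH_exp_neg hA hB hΔ hμ hφ₁ hφ₂ hc
  set r := (t - t₀) / 2 with hr
  -- Before the sign of `H` is known, `reprMeasure` is useless, since it cuts off negative values.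
  -- Instead a complex density carries both `ν` and `H` over a fixed positive measure. The radius
  -- `r` keeps the interval around `t` clear of the atom.
  have key := nonneg_of_laplace_iteratedDeriv (μ := atomAndLebesgue t₀)
    (g := withAtom t₀ (nu A a B b) H) (c := max c 0) (t₁ := t) (r := r) (W := W)
    (by linarith) (by linarith) (ae_atomAndLebesgue fun s hs => ht₀0.trans hs)
    (atomAndLebesgue_restrict_Icc (by linarith))
    (fun x hx => integrable_withAtom
      (laplace_foxH hA hB hΔ hμ hφ₁ hφ₂ hc ((le_max_left _ _).trans_lt hx)).1)
    (fun x hx => by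
      obtain ⟨h1, h2⟩ := laplace_foxH hA hB hΔ hμ hφ₁ hφ₂ hc ((le_max_left _ _).trans_lt hx)
      rw [integral_withAtom h1, hW x hx, h2])
    (fun n x hx => hWcm.2.2 n x ((le_max_right _ _).trans_lt hx))
    (by
      refine (hcont.continuousAt (Ioi_mem_nhds ht)).congr ?_
      filter_upwards [Ioi_mem_nhds ht] with s hs
      rw [withAtom_of_gt _ _ hs])
  rwa [withAtom_of_gt _ _ ht] at key

end Representation

section Continuation

variable {p q : ℕ} {A a : Fin p → ℝ} {B b : Fin q → ℝ}

lemma gammaRatio_eq_div_prod_inv (A a : Fin p → ℝ) (B b : Fin q → ℝ) (x : ℝ) :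
    (gammaRatio A a B b x : ℂ) = (∏ j, (Gamma ((B j : ℂ) * x + b j))⁻¹) /
      ∏ k, (Gamma ((A k : ℂ) * x + a k))⁻¹ := by
  rw [← gammaRatioC_ofReal, gammaRatioC, Finset.prod_inv_distrib, Finset.prod_inv_distrib,
    div_inv_eq_mul, inv_mul_eq_div]

lemma prod_inv_Gamma_ne_zero {x : ℝ} (hx : ∀ (k : Fin p) (n : ℕ), A k * x + a k ≠ -(n : ℝ)) :
    ∏ k, (Gamma ((A k : ℂ) * x + a k))⁻¹ ≠ 0 := by
  refine Finset.prod_ne_zero_iff.2 fun k _ => inv_ne_zero (Gamma_ne_zero fun n h => hx k n ?_)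
  exact_mod_cast h

/-- The excluded points are countable. -/
lemma dense_ne_pole (hA : ∀ k, 0 < A k) (a : Fin p → ℝ) :
    Dense {x : ℝ | ∀ (k : Fin p) (n : ℕ), A k * x + a k ≠ -(n : ℝ)} := by
  have hcount : (Set.range fun z : Fin p × ℕ => (-(z.2 : ℝ) - a z.1) / A z.1).Countable :=
    Set.countable_range _
  refine Dense.mono ?_ (hcount.dense_compl ℝ)
  intro x hx k n h
  refine hx ⟨(k, n), ?_⟩
  simp only
  rw [div_eq_iff (hA k).ne']
  linarith

/-- A Laplace transform that agrees with the gamma ratio far to the right agrees with its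
continuous extension on all of `(0, ∞)`. -/
lemma eq_laplace_of_eq_gammaRatio (hA : ∀ k, 0 < A k) {W : ℝ → ℝ}
    (hW : ∀ x : ℝ, 0 < x → (∀ (k : Fin p) (n : ℕ), A k * x + a k ≠ -(n : ℝ)) →
      W x = gammaRatio A a B b x)
    (hWc : ContinuousOn W (Set.Ioi 0)) {m : Measure ℝ}
    (hint : ∀ x : ℝ, 0 < x → Integrable (fun t : ℝ => Real.exp (-(x * t))) m) {c : ℝ}
    (hpole : ∀ x : ℝ, c < x → ∀ (k : Fin p) (n : ℕ), A k * x + a k ≠ -(n : ℝ))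
    (hL : ∀ x : ℝ, c < x → gammaRatio A a B b x = ∫ t, Real.exp (-(x * t)) ∂m) {x : ℝ}
    (hx : 0 < x) : W x = ∫ t, Real.exp (-(x * t)) ∂m := by
  have hdiff := differentiableOn_laplace hint
  -- Multiplying through by the reciprocal gammas of the numerator makes both sides holomorphic for
  -- `Re z > 0`, so poles of the numerator in `(0, c]` cause no trouble.
  have heq := eqOn_halfPlane
    (f := fun z => (∏ k, (Gamma ((A k : ℂ) * z + a k))⁻¹) * ∫ t : ℝ, exp (-(z * t)) ∂m)
    (g := fun z => ∏ j, (Gamma ((B j : ℂ) * z + b j))⁻¹) (c := c)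
    ((prod_inv_Gamma_differentiable A a).differentiableOn.mul hdiff)
    (prod_inv_Gamma_differentiable B b).differentiableOn (fun x hx => by
      rw [integral_exp_ofReal, ← hL x hx, gammaRatio_eq_div_prod_inv,
        mul_div_cancel₀ _ (prod_inv_Gamma_ne_zero (hpole x hx))])
  have hoff : ∀ y : ℝ, 0 < y → (∀ (k : Fin p) (n : ℕ), A k * y + a k ≠ -(n : ℝ)) →
      W y = ∫ t, Real.exp (-(y * t)) ∂m := fun y hy hne => by
    have h1 := heq (show (y : ℂ) ∈ {z : ℂ | 0 < z.re} by simpa using hy)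
    simp only at h1
    rw [hW y hy hne, ← ofReal_inj, ← integral_exp_ofReal, gammaRatio_eq_div_prod_inv, ← h1,
      mul_div_cancel_left₀ _ (prod_inv_Gamma_ne_zero hne)]
  have hLc : ContinuousAt (fun y : ℝ => ∫ t, Real.exp (-(y * t)) ∂m) x := by
    have h1 : ContinuousAt (fun z : ℂ => ∫ t : ℝ, exp (-(z * t)) ∂m) (x : ℂ) :=
      (hdiff.differentiableAt ((isOpen_lt continuous_const continuous_re).mem_nhds
        (by simpa using hx))).continuousAt
    have h2 := continuous_re.continuousAt.comp
      (h1.comp (f := fun y : ℝ => (y : ℂ)) continuous_ofReal.continuousAt)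
    refine h2.congr (Eventually.of_forall fun y => ?_)
    simp only [Function.comp_apply, integral_exp_ofReal, ofReal_re]
  have hWx : ContinuousAt W x := hWc.continuousAt (Ioi_mem_nhds hx)
  set S := {x : ℝ | ∀ (k : Fin p) (n : ℕ), A k * x + a k ≠ -(n : ℝ)} with hS
  have hne : (𝓝[S] x).NeBot := mem_closure_iff_nhdsWithin_neBot.1 (dense_ne_pole hA a x)
  -- At the removable singularities the identity follows by continuity from the dense set `S`.
  refine tendsto_nhds_unique (hWx.mono_left (nhdsWithin_le_nhds (s := S))) ?_
  refine (hLc.mono_left (nhdsWithin_le_nhds (s := S))).congr' ?_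
  filter_upwards [self_mem_nhdsWithin, mem_nhdsWithin_of_mem_nhds (Ioi_mem_nhds hx)] with y hy hy0
  exact (hoff y hy0 hy).symm

end Continuation

end FoxH

/-! ### The theorem. -/

open FoxH MeasureTheory in
theorem corollary2p1 {p q : ℕ} (A a : Fin p → ℝ) (B b : Fin q → ℝ)
    (hA : ∀ k, 0 < A k) (hB : ∀ j, 0 < B j)
    (hΔ : (∑ j, B j) - (∑ k, A k) = 0) (hμ : FoxH.mu a b = 0) (hρ : FoxH.rho A B ≤ 1)
    -- `W` is the gamma ratio on `(0, ∞)`, with its removable singularities filled in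
    (W : ℝ → ℝ)
    (hW : ∀ x : ℝ, 0 < x → (∀ (k : Fin p) (n : ℕ), A k * x + a k ≠ -(n : ℝ)) →
      W x = FoxH.gammaRatio A a B b x)
    (hWcm : FoxH.IsCompletelyMonotonic W)
    -- an arbitrary left loop around the poles of the integrand that defines `H`
    (c φ₁ φ₂ : ℝ) (hφ₁ : φ₁ < 0) (hφ₂ : 0 < φ₂) (hc : ∀ k, -a k / A k < c) :
    -- `H` is real and nonnegative on `(0, ρ)`
    (∀ x : ℝ, 0 < x → x < FoxH.rho A B →
      (FoxH.foxH c φ₁ φ₂ A a B b x).im = 0 ∧ 0 ≤ (FoxH.foxH c φ₁ φ₂ A a B b x).re) ∧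
    -- the measure `ν δ_{-log ρ} + H(e^{-t}) dt` represents `W`
    (∀ x : ℝ, 0 < x →
      MeasureTheory.IntegrableOn (fun t : ℝ => Real.exp (-(x * t)))
        (Set.Ici (-Real.log (FoxH.rho A B))) (FoxH.reprMeasure c φ₁ φ₂ A a B b) ∧
      W x = ∫ t in Set.Ici (-Real.log (FoxH.rho A B)), Real.exp (-(x * t))
        ∂(FoxH.reprMeasure c φ₁ φ₂ A a B b)) ∧
    -- it is the only measure on `[0, ∞)` that represents `W`
    (∀ m : MeasureTheory.Measure ℝ, m (Set.Iio 0) = 0 →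
      (∀ x : ℝ, 0 < x → MeasureTheory.Integrable (fun t : ℝ => Real.exp (-(x * t))) m ∧
        W x = ∫ t, Real.exp (-(x * t)) ∂m) →
      m = FoxH.reprMeasure c φ₁ φ₂ A a B b) := by
  have hρ0 := rho_pos hA hB
  set t₀ := -Real.log (rho A B) with ht₀
  have ht₀0 : 0 ≤ t₀ := neg_nonneg.2 (Real.log_nonpos hρ0.le hρ)
  set M := reprMeasure c φ₁ φ₂ A a B b with hM
  -- The loop may have `c < 0`, whereas `W` is known only on `(0, ∞)`; hence `max c 0`.
  have hpole : ∀ x : ℝ, max c 0 < x → ∀ (k : Fin p) (n : ℕ), A k * x + a k ≠ -(n : ℝ) := by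
    intro x hx k n h
    have h1 := (div_lt_iff₀ (hA k)).1 ((hc k).trans ((le_max_left c 0).trans_lt hx))
    have h2 : (0 : ℝ) ≤ n := Nat.cast_nonneg n
    linarith
  have hWr : ∀ x : ℝ, max c 0 < x → W x = gammaRatio A a B b x := fun x hx =>
    hW x ((le_max_right _ _).trans_lt hx) (hpole x hx)
  have hH : ∀ t : ℝ, t₀ < t → (foxH c φ₁ φ₂ A a B b (Real.exp (-t))).im = 0 ∧
      0 ≤ (foxH c φ₁ φ₂ A a B b (Real.exp (-t))).re := fun t ht =>
    foxH_nonneg hA hB hΔ hμ hρ hWr hWcm hφ₁ hφ₂ hc ht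
  have hright : ∀ x : ℝ, max c 0 < x → Integrable (fun t : ℝ => Real.exp (-(x * t))) M ∧
      gammaRatio A a B b x = ∫ t, Real.exp (-(x * t)) ∂M := by
    intro x hx
    obtain ⟨h1, h2⟩ := laplace_foxH hA hB hΔ hμ hφ₁ hφ₂ hc ((le_max_left c 0).trans_lt hx)
    obtain ⟨h3, h4⟩ := laplace_reprMeasure hA hB
      (continuousOn_foxH_exp_neg hA hB hΔ hμ hφ₁ hφ₂ hc) hH h1
    exact ⟨h3, Complex.ofReal_injective (h2.trans h4.symm)⟩
  have hsupp : ∀ᵐ t ∂M, 0 ≤ t := by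
    rw [ae_iff]
    refine measure_mono_null (fun t ht => ?_) (reprMeasure_Iio c φ₁ φ₂ A a B b)
    exact (not_le.1 ht).trans_le ht₀0
  have hint : ∀ x : ℝ, 0 < x → Integrable (fun t : ℝ => Real.exp (-(x * t))) M := fun x hx =>
    integrable_exp_of_isCompletelyMonotonic hWcm hsupp (fun x hx => (hright x hx).1)
      (fun x hx => (hWr x hx).trans (hright x hx).2) hx
  have hrep : ∀ x : ℝ, 0 < x → W x = ∫ t, Real.exp (-(x * t)) ∂M := fun x hx =>
    eq_laplace_of_eq_gammaRatio hA hW hWcm.2.1.continuousOn hint hpole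
      (fun x hx => (hright x hx).2) hx
  refine ⟨fun x hx hxρ => ?_, fun x hx => ⟨(hint x hx).integrableOn, ?_⟩, fun m _ hm => ?_⟩
  · have := hH (-Real.log x) (neg_lt_neg (Real.log_lt_log hx hxρ))
    rwa [neg_neg, Real.exp_log hx] at this
  · rw [hrep x hx, hM, ht₀, reprMeasure_restrict_Ici]
  · exact measure_ext_of_laplace (fun x hx => (hm x hx).1) hint
      fun x hx => (hm x hx).2.symm.trans (hrep x hx)
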